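/- Let $\Omega\subset\mathbb{R}^2$ be a bounded, simply connected, open set whose boundary is a finite union of line segments (a polygonal domain; no convexity is assumed). Let $H^1_0(\Omega)=\{v\in H^1(\Omega): v=0 \text{ on }\partial\Omega\}$, $H^2_0(\Omega)=\{v\in H^2(\Omega): v=\partial_n v=0\text{ on }\partial\Omega\}$, $$\mathbf{H}=\{\mathbf{v}\in L^2(\Omega)^2:\ \nabla\cdot\mathbf{v}=0 \text{ in }\Omega,\ \mathbf{n}\cdot\mathbf{v}=0\text{ on }\partial\Omega\},\qquad \mathbf{V}=\{\mathbf{v}\in H^1_0(\Omega)^2:\ \nabla\cdot\mathbf{v}=0\},$$ with the norms $\|v\|_{H^1_0}=\|\nabla v\|_{L^2(\Omega)}$, $\|v\|_{H^2_0}=\|\Delta v\|_{L^2(\Omega)}$, $\|\mathbf{v}\|_{\mathbf{H}}=\|\mathbf{v}\|_{L^2(\Omega)}$, $\|\mathbf{v}\|_{\mathbf{V}}=\|\nabla\mathbf{v}\|_{L^2(\Omega)}$. Vanishing on $\partial\Omega$ is understood as membership in the closure of $C_c^\infty(\Omega)$ in $H^1(\Omega)$, and $\mathbf{n}\cdot\mathbf{v}=0$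 for $\mathbf{v}\in L^2(\Omega)^2$ with $\nabla\cdot\mathbf{v}\in L^2(\Omega)$ (also for $\partial_n v=\mathbf{n}\cdot\nabla v$) as $\int_\Omega \mathbf{v}\cdot\nabla\varphi+\int_\Omega(\nabla\cdot\mathbf{v})\varphi=0$ for all $\varphi\in H^1(\Omega)$. There is a constant $C>0$, depending only on $\Omega$, such that the following holds for every $\mathbf{u}_0\in\mathbf{H}$. The problem $$-\Delta\psi_0=-\operatorname{curl}(\mathbf{u}_0)\ \text{ in }\Omega,\qquad \psi_0=0\ \text{ on }\partial\Omega,\qquad \operatorname{curl}(\mathbf{v})=\partial_2\mathbf{v}_1-\partial_1\mathbf{v}_2,$$ understood in the weak sense, i.e. $\psi_0\in H^1_0(\Omega)$ and $\int_\Omega\nabla\psi_0\cdot\nabla\varphi=\int_\Omega(\mathbf{u}_{0,1}\,\partial_2\varphi-\mathbf{u}_{0,2}\,\partial_1\varphi)$ for all $\varphi\in H^1_0(\Omega)$, has a unique solution $\psi_0\in H^1_0(\Omega)$, and $$\|\psi_0\|_{H^1_0(\Omega)}\le C\,\|\mathbf{u}_0\|_{\mathbf{H}}.$$ If furthermore $\mathbf{u}_0\in\mathbf{V}$,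 then $\psi_0\in H^2_0(\Omega)$ and $$\|\psi_0\|_{H^2_0(\Omega)}\le C\,\|\mathbf{u}_0\|_{\mathbf{V}}.$$ -/

import Mathlib

open MeasureTheory
open scoped ContDiff ENNReal

noncomputable section

namespace StreamFunction

/-- The Euclidean plane; the coordinates `x₁, x₂` of the text are `x 0, x 1`. -/
abbrev Plane : Type := EuclideanSpace ℝ (Fin 2)

/-- A polygonal set: open, bounded, with a boundary that is a finite union of line segments.
Neither convexity nor a Lipschitz boundary is required. -/
structure IsPolygonal (Ω : Set Plane) : Prop where
  isOpen : IsOpen Ω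
  isBounded : Bornology.IsBounded Ω
  frontier_eq : ∃ S : Finset (Plane × Plane), frontier Ω = ⋃ p ∈ S, segment ℝ p.1 p.2

/-- The space `L²(Ω)` of real functions. -/
abbrev L2 (Ω : Set Plane) : Type := Lp ℝ 2 (volume.restrict Ω)

/-- The test functions on `Ω`: smooth, with compact support contained in `Ω`. -/
structure IsTest (Ω : Set Plane) (φ : Plane → ℝ) : Prop where
  smooth : ContDiff ℝ ∞ φ
  compact : HasCompactSupport φ
  support : tsupport φ ⊆ Ω

/-- The classical partial derivative `∂ᵢφ`. -/
def pderiv (i : Fin 2) (φ : Plane → ℝ) (x : Plane) : ℝ :=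
  fderiv ℝ φ x (EuclideanSpace.single i 1)

/-- `g ∈ L²(Ω)` is the weak partial derivative `∂ᵢf` of `f ∈ L²(Ω)`. -/
def HasWeakDeriv (Ω : Set Plane) (i : Fin 2) (f g : L2 Ω) : Prop :=
  ∀ φ : Plane → ℝ, IsTest Ω φ →
    ∫ x in Ω, f x * pderiv i φ x = -∫ x in Ω, g x * φ x

/-- Weak derivatives are unique. -/
theorem HasWeakDeriv.unique {Ω : Set Plane} (hΩ : IsOpen Ω) {i : Fin 2} {f g g' : L2 Ω}
    (h : HasWeakDeriv Ω i f g) (h' : HasWeakDeriv Ω i f g') : g = g' := by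
  have hloc : ∀ k : L2 Ω, LocallyIntegrable k (volume.restrict Ω) := fun k =>
    (Lp.memLp k).locallyIntegrable (by norm_num)
  have hI : ∀ (k : L2 Ω) (φ : Plane → ℝ), IsTest Ω φ →
      Integrable (fun x => φ x • k x) (volume.restrict Ω) := fun k φ hφ =>
    (hloc k).integrable_smul_left_of_hasCompactSupport hφ.smooth.continuous hφ.compact
  have key : ∀ᵐ x ∂(volume : Measure Plane), x ∈ Ω → g x - g' x = 0 := by
    apply hΩ.ae_eq_zero_of_integral_contDiff_smul_eq_zero
    · exact locallyIntegrableOn_of_locallyIntegrable_restrict ((hloc g).sub (hloc g'))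
    · intro φ h1 h2 h3
      have hφ : IsTest Ω φ := ⟨h1, h2, h3⟩
      have e : ∫ x in Ω, g x * φ x = ∫ x in Ω, g' x * φ x :=
        neg_injective ((h φ hφ).symm.trans (h' φ hφ))
      have e2 : ∫ x in Ω, φ x • (g x - g' x) = 0 := by
        simp_rw [smul_sub]
        rw [integral_sub (hI g φ hφ) (hI g' φ hφ), sub_eq_zero]
        simpa [mul_comm] using e
      rw [← e2]
      refine (setIntegral_eq_integral_of_forall_compl_eq_zero fun x hx => ?_).symm
      rw [image_eq_zero_of_notMem_tsupport fun hh => hx (h3 hh), zero_smul]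
  apply Lp.ext
  rw [Filter.EventuallyEq, ae_restrict_iff' hΩ.measurableSet]
  filter_upwards [key] with x hx hxΩ
  exact sub_eq_zero.mp (hx hxΩ)

open Classical in
/-- The weak partial derivative `∂ᵢf`, for `f ∈ L²(Ω)` that has one in `L²(Ω)`. -/
def weakDeriv (Ω : Set Plane) (i : Fin 2) (f : L2 Ω) : L2 Ω :=
  if h : ∃ g, HasWeakDeriv Ω i f g then h.choose else 0

/-- The Sobolev space `H¹(Ω)`. -/
def H1 (Ω : Set Plane) : Set (L2 Ω) :=
  {f | ∀ i, ∃ g, HasWeakDeriv Ω i f g}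

/-- The Sobolev space `H²(Ω)`. -/
def H2 (Ω : Set Plane) : Set (L2 Ω) :=
  {f | f ∈ H1 Ω ∧ ∀ i, weakDeriv Ω i f ∈ H1 Ω}

/-- The space `H¹₀(Ω)` of the functions in `H¹(Ω)` that vanish on `∂Ω`: the closure of the test
functions in `H¹(Ω)`. -/
def H10 (Ω : Set Plane) : Set (L2 Ω) :=
  {f | f ∈ H1 Ω ∧ ∀ ε : ℝ≥0∞, 0 < ε → ∃ φ : Plane → ℝ, IsTest Ω φ ∧
    eLpNorm (fun x => f x - φ x) 2 (volume.restrict Ω) < ε ∧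
    ∀ i, eLpNorm (fun x => weakDeriv Ω i f x - pderiv i φ x) 2 (volume.restrict Ω) < ε}

/-- The weak gradient `∇f = (∂₁f, ∂₂f)`. -/
def grad (Ω : Set Plane) (f : L2 Ω) : Fin 2 → L2 Ω := fun i => weakDeriv Ω i f

/-- The Laplacian `Δf = ∂₁∂₁f + ∂₂∂₂f` of `f ∈ H²(Ω)`. -/
def laplacian (Ω : Set Plane) (f : L2 Ω) : L2 Ω :=
  ∑ i, weakDeriv Ω i (weakDeriv Ω i f)

/-- `d ∈ L²(Ω)` is the weak divergence `∇ · v` of the vector field `v ∈ L²(Ω)²`. -/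
def HasWeakDiv (Ω : Set Plane) (v : Fin 2 → L2 Ω) (d : L2 Ω) : Prop :=
  ∀ φ : Plane → ℝ, IsTest Ω φ →
    ∫ x in Ω, ∑ i, v i x * pderiv i φ x = -∫ x in Ω, d x * φ x

/-- The normal trace `n · v = 0` on `∂Ω` of a field `v ∈ L²(Ω)²` with `∇ · v = d ∈ L²(Ω)`.
As usual, `n · v` is the functional on the boundary values of the functions `φ ∈ H¹(Ω)` given by
Green's formula, `⟨n · v, φ⟩ = ∫_Ω v · ∇φ + ∫_Ω (∇ · v) φ`. -/
def NormalTraceZero (Ω : Set Plane) (v : Fin 2 → L2 Ω) (d : L2 Ω) : Prop :=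
  ∀ φ ∈ H1 Ω, (∫ x in Ω, ∑ i, v i x * grad Ω φ i x) + ∫ x in Ω, d x * φ x = 0

/-- The space `H²₀(Ω)` of the `f ∈ H²(Ω)` with `f = ∂ₙf = 0` on `∂Ω`, where `∂ₙf = n · ∇f`
and `∇ · ∇f = Δf`. -/
def H20 (Ω : Set Plane) : Set (L2 Ω) :=
  {f | f ∈ H2 Ω ∧ f ∈ H10 Ω ∧ NormalTraceZero Ω (grad Ω f) (laplacian Ω f)}

/-- The space `H` of the `v ∈ L²(Ω)²` with `∇ · v = 0` in `Ω` and `n · v = 0` on `∂Ω`. -/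
def spaceH (Ω : Set Plane) : Set (Fin 2 → L2 Ω) :=
  {v | HasWeakDiv Ω v 0 ∧ NormalTraceZero Ω v 0}

/-- The space `V` of the `v ∈ H¹₀(Ω)²` with `∇ · v = 0`. -/
def spaceV (Ω : Set Plane) : Set (Fin 2 → L2 Ω) :=
  {v | (∀ i, v i ∈ H10 Ω) ∧ ∑ i, weakDeriv Ω i (v i) = 0}

/-- The norm of `H`, `‖v‖ = (∫_Ω |v₁|² + |v₂|²)^{1/2}`, that is, the norm of `L²(Ω)²`. -/
def normH {Ω : Set Plane} (v : Fin 2 → L2 Ω) : ℝ := Real.sqrt (∑ i, ‖v i‖ ^ 2)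

/-- The norm of `H¹₀(Ω)`, `‖∇f‖` in `L²(Ω)²`. -/
def normH10 {Ω : Set Plane} (f : L2 Ω) : ℝ := normH (grad Ω f)

/-- The norm of `V`, that is of `H¹₀(Ω)²`, `‖∇v‖ = (∫_Ω ∇v : ∇v)^{1/2}`. -/
def normV {Ω : Set Plane} (v : Fin 2 → L2 Ω) : ℝ := Real.sqrt (∑ j, normH10 (v j) ^ 2)

/-- The norm of `H²₀(Ω)`, `‖Δf‖` in `L²(Ω)`. -/
def normH20 {Ω : Set Plane} (f : L2 Ω) : ℝ := ‖laplacian Ω f‖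

/-- The scalar curl `curl v = ∂₂v₁ - ∂₁v₂` of `v ∈ L²(Ω)²` as an element of `H⁻¹(Ω)`: its value
`⟨curl v, φ⟩ = -∫_Ω (v₁ ∂₂φ - v₂ ∂₁φ)` at `φ ∈ H¹₀(Ω)`. -/
def scalarCurl (Ω : Set Plane) (v : Fin 2 → L2 Ω) (φ : L2 Ω) : ℝ :=
  -∫ x in Ω, (v 0 x * weakDeriv Ω 1 φ x - v 1 x * weakDeriv Ω 0 φ x)

/-- `ψ` is a (weak) solution of `-Δψ = -curl u` in `Ω`, `ψ = 0` on `∂Ω`. -/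
def IsInitialStreamFunction (Ω : Set Plane) (u : Fin 2 → L2 Ω) (ψ : L2 Ω) : Prop :=
  ψ ∈ H10 Ω ∧ ∀ φ ∈ H10 Ω,
    ∫ x in Ω, ∑ i, grad Ω ψ i x * grad Ω φ i x = -scalarCurl Ω u φ

end StreamFunction

end

/-!
Only boundedness, openness and simple connectedness of `Ω` matter. Components and partial
derivatives are numbered `0, 1`, as in the code.

The weak problem says that `∇ψ` is the orthogonal projection of the rotated field `(-u₁, u₀)` on
the closure of the gradients of the test functions. By the Poincaré inequality
(`exists_norm_le_pderiv`) this closure consists of the gradients of `H¹₀(Ω)`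
(`exists_grad_eq_of_mem_gradSpace`), and a function in `H¹₀(Ω)` is determined by its gradient
(`eq_of_grad_eq`). This gives existence, uniqueness and the first bound.

For `u ∈ H` the projection is the field itself, that is, `u = (∂₁ψ, -∂₀ψ)`
(`IsInitialStreamFunction.grad_eq`). Indeed, the difference `a` of the two sides is divergence
free, curl free and has vanishing normal trace. Such a field vanishes on a simply connected set
(`IsHarmonicField.eq_zero`). To see this, one finds a potential `F` with `∇F = a` and tests the
normal trace condition with `arctan ∘ F`, which is bounded and hence in `H¹(Ω)` whatever the
regularity of the boundary. This yields `∫ |a|² / (1 + F²) = 0`.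

The potential comes from two facts.
* Weyl's lemma, `IsHarmonicField.ae_eq_mollify`: the mollification of `a` by a radial kernel
  `t² B(t z)` does not depend on `t`. Its derivative in `t` is the integral of `a` against the
  divergence of the field `z ↦ t B(t z) z`, which vanishes since this field is curl free. So `a` is
  smooth, and locally it has a potential by the classical Poincaré lemma on discs.
* Local potentials differ by locally constant functions, and these can be glued over a simply
  connected space (`exists_sub_locally_const_of_simplyConnected`), because the graphs of all local
  potentials form a covering space.

If moreover `u ∈ V`, then the components of `∇ψ` are, up to sign, in `H¹₀(Ω)`. Green's formula
for these components is the Neumann condition in `H²₀(Ω)` (`mem_H20_of_grad_eq`).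
-/

noncomputable section

namespace StreamFunction

/-! ### Gluing local functions over a simply connected space -/

open Topology in
/-- Over a simply connected space a locally constant cocycle is trivial: if the functions `F i` on
the members `U i` of an open cover differ by locally constant functions on the overlaps, there is
a global function `h` that differs from each `F i` by a locally constant function on `U i`. The
functions `F i + c` form a covering space with fibre `ℝ`, and `h` is a section of it. -/
theorem exists_sub_locally_const_of_simplyConnected {X : Type*} [TopologicalSpace X]
    [SimplyConnectedSpace X] [LocallyPathConnectedSpace X] {ι : Type*} (U : ι → Set X)
    (hU : ∀ i, IsOpen (U i)) (hcov : ∀ x, ∃ i, x ∈ U i) (F : ι → X → ℝ)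
    (hF : ∀ i j, ∀ x ∈ U i ∩ U j, ∀ᶠ y in 𝓝 x, F i y - F j y = F i x - F j x) :
    ∃ h : X → ℝ, ∀ i, ∀ x ∈ U i, ∀ᶠ y in 𝓝 x, h y - F i y = h x - F i x := by
  choose idx hidx using hcov
  -- The fibre is `ℝ` with the discrete topology.
  let _ : TopologicalSpace ℝ := ⊥
  have : DiscreteTopology ℝ := ⟨rfl⟩
  -- In the chart `i` the germ of `F i + v` at `x` has the coordinate `v`.
  let Z : FiberBundleCore ι X ℝ :=
    { baseSet := U
      isOpen_baseSet := hU
      indexAt := idx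
      mem_baseSet_at := hidx
      coordChange := fun i j x v => v + (F i x - F j x)
      coordChange_self := fun i x _ v => by ring
      continuousOn_coordChange := fun i j => by
        rintro ⟨x, v⟩ ⟨hx, -⟩
        apply ContinuousAt.continuousWithinAt
        have h1 : ∀ᶠ p : X × ℝ in 𝓝 (x, v), p.2 + (F i p.1 - F j p.1) = v + (F i x - F j x) := by
          rw [nhds_prod_eq, nhds_discrete ℝ]
          have h2 : ∀ᶠ w in (pure v : Filter ℝ), w = v := by simp
          filter_upwards [(hF i j x hx).prod_mk h2] with p hp
          rw [hp.1, hp.2]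
        exact (continuousAt_const (y := v + (F i x - F j x))).congr (h1.mono fun p hp => hp.symm)
      coordChange_comp := fun i j k x _ v => by ring }
  have hcovmap : IsCoveringMap Z.proj := FiberBundle.isCoveringMap (F := ℝ) (E := Z.Fiber)
  obtain ⟨x₀⟩ : Nonempty X := inferInstance
  obtain ⟨s, ⟨-, hs⟩, -⟩ := hcovmap.existsUnique_continuousMap_lifts (ContinuousMap.id X) x₀
    (⟨x₀, (0 : ℝ)⟩ : Z.TotalSpace) rfl
  have hs1 : ∀ x, (s x).1 = x := fun x => congrFun hs x
  let σ : X → ℝ := fun x => (s x).2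
  refine ⟨fun x => σ x + F (idx x) x, fun i x hx => ?_⟩
  have hc : ContinuousAt (fun y => (Z.localTriv i (s y)).2) x := by
    have h1 : ContinuousAt (Z.localTriv i) (s x) :=
      (Z.localTriv i).continuousAt (by rw [Z.mem_localTriv_source, hs1]; exact hx)
    exact (continuous_snd.continuousAt.comp h1).comp s.continuous.continuousAt
  have hform : ∀ y, (Z.localTriv i (s y)).2 = σ y + F (idx y) y - F i y := by
    intro y
    change σ y + (F (idx (s y).1) (s y).1 - F i (s y).1) = _
    rw [hs1]; ring
  have hev : ∀ᶠ y in 𝓝 x, (Z.localTriv i (s y)).2 = (Z.localTriv i (s x)).2 := by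
    have := hc.tendsto
    rw [nhds_discrete ℝ, Filter.tendsto_pure] at this
    exact this
  filter_upwards [hev] with y hy
  rw [hform, hform] at hy
  exact hy

variable {Ω : Set Plane} {φ χ : Plane → ℝ} {i : Fin 2}

/-! ### Test functions -/

theorem IsTest.pderiv (hφ : IsTest Ω φ) (i : Fin 2) : IsTest Ω (pderiv i φ) where
  smooth := (hφ.smooth.fderiv_right (m := ∞) (by simp)).clm_apply contDiff_const
  compact := hφ.compact.fderiv_apply ℝ _
  support := (tsupport_fderiv_apply_subset ℝ _).trans hφ.support

theorem IsTest.continuous (hφ : IsTest Ω φ) : Continuous φ := hφ.smooth.continuous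

theorem IsTest.differentiable (hφ : IsTest Ω φ) : Differentiable ℝ φ :=
  hφ.smooth.differentiable (by simp)

theorem IsTest.memLp (hφ : IsTest Ω φ) : MemLp φ 2 (volume.restrict Ω) :=
  hφ.continuous.memLp_of_hasCompactSupport hφ.compact

/-- A test function as an element of `L²(Ω)`. -/
def IsTest.toL2 (hφ : IsTest Ω φ) : L2 Ω := hφ.memLp.toLp φ

theorem IsTest.coeFn_toL2 (hφ : IsTest Ω φ) : hφ.toL2 =ᵐ[volume.restrict Ω] φ :=
  hφ.memLp.coeFn_toLp

theorem IsTest.add (hφ : IsTest Ω φ) (hχ : IsTest Ω χ) : IsTest Ω (φ + χ) where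
  smooth := hφ.smooth.add hχ.smooth
  compact := hφ.compact.add hχ.compact
  support := (tsupport_add _ _).trans (Set.union_subset hφ.support hχ.support)

theorem IsTest.const_smul (hφ : IsTest Ω φ) (c : ℝ) : IsTest Ω (c • φ) where
  smooth := hφ.smooth.const_smul c
  compact := hφ.compact.smul_left (f := fun _ => c)
  support := (tsupport_smul_subset_right (fun _ => c) φ).trans hφ.support

theorem IsTest.sub (hφ : IsTest Ω φ) (hχ : IsTest Ω χ) : IsTest Ω (φ - χ) where
  smooth := hφ.smooth.sub hχ.smooth
  compact := hφ.compact.sub hχ.compact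
  support := (tsupport_sub _ _).trans (Set.union_subset hφ.support hχ.support)

theorem isTest_zero : IsTest Ω (0 : Plane → ℝ) where
  smooth := contDiff_const
  compact := HasCompactSupport.zero
  support := by simp [tsupport]

theorem IsTest.pderiv_add (hφ : IsTest Ω φ) (hχ : IsTest Ω χ) (i : Fin 2) :
    StreamFunction.pderiv i (φ + χ) =
      StreamFunction.pderiv i φ + StreamFunction.pderiv i χ := by
  funext x
  simp [StreamFunction.pderiv, fderiv_add (hφ.differentiable x) (hχ.differentiable x)]

theorem IsTest.pderiv_sub (hφ : IsTest Ω φ) (hχ : IsTest Ω χ) (i : Fin 2) :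
    StreamFunction.pderiv i (φ - χ) =
      StreamFunction.pderiv i φ - StreamFunction.pderiv i χ := by
  funext x
  simp [StreamFunction.pderiv, fderiv_sub (hφ.differentiable x) (hχ.differentiable x)]

theorem IsTest.pderiv_const_smul (hφ : IsTest Ω φ) (c : ℝ) (i : Fin 2) :
    StreamFunction.pderiv i (c • φ) = c • StreamFunction.pderiv i φ := by
  funext x
  simp [StreamFunction.pderiv, fderiv_const_smul (hφ.differentiable x) c]

theorem IsTest.toL2_congr (hφ : IsTest Ω φ) (hχ : IsTest Ω χ) (h : φ = χ) :
    hφ.toL2 = hχ.toL2 := by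
  subst h; rfl

theorem IsTest.pderiv_comm (hφ : IsTest Ω φ) (i j : Fin 2) :
    StreamFunction.pderiv i (StreamFunction.pderiv j φ) =
      StreamFunction.pderiv j (StreamFunction.pderiv i φ) := by
  funext x
  have hd : DifferentiableAt ℝ (fderiv ℝ φ) x :=
    (hφ.smooth.fderiv_right (m := ∞) (by simp)).differentiable (by simp) x
  have key : ∀ a b : Fin 2, StreamFunction.pderiv a (StreamFunction.pderiv b φ) x =
      fderiv ℝ (fderiv ℝ φ) x (EuclideanSpace.single a 1) (EuclideanSpace.single b 1) := by
    intro a b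
    unfold StreamFunction.pderiv
    rw [fderiv_clm_apply hd (differentiableAt_const _)]
    simp
  rw [key, key]
  exact (hφ.smooth.contDiffAt.isSymmSndFDerivAt
    (by
      rw [minSmoothness_of_isRCLikeNormedField]
      exact WithTop.coe_le_coe.2 (le_top : (2 : ℕ∞) ≤ ⊤))).eq _ _

/-! ### Weak derivatives in `L²` -/

theorem inner_eq_integral (f g : L2 Ω) : inner ℝ f g = ∫ x in Ω, f x * g x := by
  rw [L2.inner_def]
  simp [mul_comm]

theorem integrable_mul (f g : L2 Ω) :
    Integrable (fun x => f x * g x) (volume.restrict Ω) := by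
  simpa [mul_comm] using L2.integrable_inner (𝕜 := ℝ) f g

theorem inner_toL2 (f : L2 Ω) (hφ : IsTest Ω φ) :
    inner ℝ f hφ.toL2 = ∫ x in Ω, f x * φ x := by
  rw [inner_eq_integral]
  refine integral_congr_ae ?_
  filter_upwards [hφ.coeFn_toL2] with x hx
  rw [hx]

theorem hasWeakDeriv_iff {f g : L2 Ω} : HasWeakDeriv Ω i f g ↔
    ∀ (φ : Plane → ℝ) (hφ : IsTest Ω φ), inner ℝ f (hφ.pderiv i).toL2 = -inner ℝ g hφ.toL2 := by
  refine forall_congr' fun φ => forall_congr' fun hφ => ?_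
  rw [inner_toL2, inner_toL2]

theorem HasWeakDeriv.neg {f g : L2 Ω} (h : HasWeakDeriv Ω i f g) : HasWeakDeriv Ω i (-f) (-g) := by
  rw [hasWeakDeriv_iff] at h ⊢
  intro φ hφ
  rw [inner_neg_left, inner_neg_left, h φ hφ]

theorem HasWeakDeriv.weakDeriv_eq (hΩ : IsOpen Ω) {f g : L2 Ω} (h : HasWeakDeriv Ω i f g) :
    weakDeriv Ω i f = g := by
  have hex : ∃ g, HasWeakDeriv Ω i f g := ⟨g, h⟩
  rw [weakDeriv, dif_pos hex]
  exact hex.choose_spec.unique hΩ h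

theorem hasWeakDeriv_weakDeriv {f : L2 Ω} (hf : f ∈ H1 Ω) (i : Fin 2) :
    HasWeakDeriv Ω i f (weakDeriv Ω i f) := by
  rw [weakDeriv, dif_pos (hf i)]
  exact (hf i).choose_spec

theorem neg_mem_H1 {f : L2 Ω} (hf : f ∈ H1 Ω) : -f ∈ H1 Ω :=
  fun i => ⟨_, (hasWeakDeriv_weakDeriv hf i).neg⟩

theorem weakDeriv_neg (hΩ : IsOpen Ω) {f : L2 Ω} (hf : f ∈ H1 Ω) (i : Fin 2) :
    weakDeriv Ω i (-f) = -weakDeriv Ω i f :=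
  (hasWeakDeriv_weakDeriv hf i).neg.weakDeriv_eq hΩ

theorem IsTest.integrable_continuousOn_mul (hφ : IsTest Ω φ) (hΩ : IsOpen Ω) {u : Plane → ℝ}
    (hu : ContinuousOn u Ω) : Integrable (fun x => u x * φ x) := by
  have hsub : tsupport (fun x => u x * φ x) ⊆ tsupport φ := tsupport_mul_subset_right
  refine Continuous.integrable_of_hasCompactSupport ?_ ?_
  · exact (hu.mul hφ.continuous.continuousOn).continuous_of_tsupport_subset hΩ
      (hsub.trans hφ.support)
  · exact hφ.compact.of_isClosed_subset (isClosed_tsupport _) hsub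

theorem IsTest.setIntegral_mul_eq (hφ : IsTest Ω φ) (u : Plane → ℝ) :
    ∫ x in Ω, u x * φ x = ∫ x, u x * φ x := by
  refine setIntegral_eq_integral_of_forall_compl_eq_zero fun x hx => ?_
  rw [image_eq_zero_of_notMem_tsupport fun h => hx (hφ.support h), mul_zero]

/-- Integration by parts of a function that is `C¹` in `Ω`, without control at the boundary,
against a test function. -/
theorem IsTest.setIntegral_mul_pderiv (hφ : IsTest Ω φ) (hΩ : IsOpen Ω) {h : Plane → ℝ}
    {h' : Plane → Plane →L[ℝ] ℝ} (hd : ∀ x ∈ Ω, HasFDerivAt h (h' x) x)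
    (hc : ContinuousOn h' Ω) (i : Fin 2) :
    ∫ x in Ω, h x * StreamFunction.pderiv i φ x =
      -∫ x in Ω, h' x (EuclideanSpace.single i 1) * φ x := by
  have hcont : ContinuousOn h Ω := fun x hx => (hd x hx).continuousAt.continuousWithinAt
  rw [(hφ.pderiv i).setIntegral_mul_eq, hφ.setIntegral_mul_eq]
  refine integral_bilinear_hasFDerivAt_right_eq_neg_left_of_integrable
    (B := ContinuousLinearMap.mul ℝ ℝ) (g' := fderiv ℝ φ) ?_ ?_ ?_ ?_ ?_
  · exact hφ.integrable_continuousOn_mul hΩ (hc.clm_apply continuousOn_const)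
  · exact (hφ.pderiv i).integrable_continuousOn_mul hΩ hcont
  · exact hφ.integrable_continuousOn_mul hΩ hcont
  · exact fun x hx => hd x (hφ.support hx)
  · exact fun x _ => (hφ.differentiable x).hasFDerivAt

theorem IsTest.hasWeakDeriv (hφ : IsTest Ω φ) (hΩ : IsOpen Ω) (i : Fin 2) :
    HasWeakDeriv Ω i hφ.toL2 (hφ.pderiv i).toL2 := by
  rw [hasWeakDeriv_iff]
  intro χ hχ
  have h := hχ.setIntegral_mul_pderiv hΩ (fun x _ => (hφ.differentiable x).hasFDerivAt)
    (hφ.smooth.continuous_fderiv (by simp)).continuousOn i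
  rw [inner_toL2, inner_toL2]
  convert h using 1
  · refine integral_congr_ae ?_
    filter_upwards [hφ.coeFn_toL2] with x hx
    rw [hx]
  · congr 1
    refine integral_congr_ae ?_
    filter_upwards [(hφ.pderiv i).coeFn_toL2] with x hx
    rw [hx]
    rfl

theorem eLpNorm_sub_eq (f : L2 Ω) (hφ : IsTest Ω φ) :
    eLpNorm (fun x => f x - φ x) 2 (volume.restrict Ω) = ENNReal.ofReal ‖f - hφ.toL2‖ := by
  rw [ofReal_norm, Lp.enorm_def]
  refine eLpNorm_congr_ae ?_
  filter_upwards [Lp.coeFn_sub f hφ.toL2, hφ.coeFn_toL2] with x h1 h2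
  rw [h1, Pi.sub_apply, h2]

theorem mem_H10_iff {f : L2 Ω} : f ∈ H10 Ω ↔ f ∈ H1 Ω ∧ ∀ ε : ℝ, 0 < ε →
    ∃ (φ : Plane → ℝ) (hφ : IsTest Ω φ), ‖f - hφ.toL2‖ < ε ∧
      ∀ i, ‖weakDeriv Ω i f - (hφ.pderiv i).toL2‖ < ε := by
  refine and_congr_right fun _ => ⟨fun h ε hε => ?_, fun h ε hε => ?_⟩
  · obtain ⟨φ, hφ, h1, h2⟩ := h (ENNReal.ofReal ε) (by simpa using hε)
    refine ⟨φ, hφ, ?_, fun i => ?_⟩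
    · rw [eLpNorm_sub_eq f hφ] at h1
      exact (ENNReal.ofReal_lt_ofReal_iff hε).1 h1
    · have := h2 i
      rw [eLpNorm_sub_eq _ (hφ.pderiv i)] at this
      exact (ENNReal.ofReal_lt_ofReal_iff hε).1 this
  · obtain ⟨δ, hδ, hδε⟩ := ENNReal.lt_iff_exists_nnreal_btwn.1 hε
    have hδ0 : (0 : ℝ) < δ := by simpa using hδ
    obtain ⟨φ, hφ, h1, h2⟩ := h δ hδ0
    have hle : ENNReal.ofReal (δ : ℝ) = δ := ENNReal.ofReal_coe_nnreal
    refine ⟨φ, hφ, ?_, fun i => ?_⟩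
    · rw [eLpNorm_sub_eq f hφ]
      exact ((ENNReal.ofReal_lt_ofReal_iff hδ0).2 h1).trans (hle ▸ hδε)
    · rw [eLpNorm_sub_eq _ (hφ.pderiv i)]
      exact ((ENNReal.ofReal_lt_ofReal_iff hδ0).2 (h2 i)).trans (hle ▸ hδε)

/-- Functions in `H¹₀(Ω)` are limits of sequences of test functions, together with their
gradients. -/
theorem exists_seq_of_mem_H10 {f : L2 Ω} (hf : f ∈ H10 Ω) :
    ∃ (φ : ℕ → Plane → ℝ) (hφ : ∀ n, IsTest Ω (φ n)),
      Filter.Tendsto (fun n => (hφ n).toL2) Filter.atTop (nhds f) ∧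
      ∀ i, Filter.Tendsto (fun n => ((hφ n).pderiv i).toL2) Filter.atTop
        (nhds (weakDeriv Ω i f)) := by
  have h := (mem_H10_iff.1 hf).2
  choose φ hφ h1 h2 using fun n : ℕ => h (1 / ((n : ℝ) + 1)) (by positivity)
  refine ⟨φ, hφ, ?_, fun i => ?_⟩
  · rw [tendsto_iff_norm_sub_tendsto_zero]
    refine squeeze_zero (fun _ => norm_nonneg _) (fun n => ?_)
      tendsto_one_div_add_atTop_nhds_zero_nat
    rw [norm_sub_rev]
    exact (h1 n).le
  · rw [tendsto_iff_norm_sub_tendsto_zero]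
    refine squeeze_zero (fun _ => norm_nonneg _) (fun n => ?_)
      tendsto_one_div_add_atTop_nhds_zero_nat
    rw [norm_sub_rev]
    exact (h2 n i).le

/-- Conversely, a limit of test functions whose gradients converge lies in `H¹₀(Ω)`, and its
gradient is the limit of the gradients. -/
theorem mem_H10_of_tendsto (hΩ : IsOpen Ω) {f : L2 Ω} {g : Fin 2 → L2 Ω} {φ : ℕ → Plane → ℝ}
    (hφ : ∀ n, IsTest Ω (φ n))
    (h1 : Filter.Tendsto (fun n => (hφ n).toL2) Filter.atTop (nhds f))
    (h2 : ∀ i, Filter.Tendsto (fun n => ((hφ n).pderiv i).toL2) Filter.atTop (nhds (g i))) :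
    f ∈ H10 Ω ∧ grad Ω f = g := by
  have hw : ∀ i, HasWeakDeriv Ω i f (g i) := by
    intro i
    rw [hasWeakDeriv_iff]
    intro χ hχ
    refine tendsto_nhds_unique (h1.inner (𝕜 := ℝ) tendsto_const_nhds) ?_
    have := ((h2 i).inner (𝕜 := ℝ) (tendsto_const_nhds (x := hχ.toL2))).neg
    refine this.congr fun n => ?_
    rw [hasWeakDeriv_iff.1 ((hφ n).hasWeakDeriv hΩ i) χ hχ]
  have hgrad : ∀ i, weakDeriv Ω i f = g i := fun i => (hw i).weakDeriv_eq hΩ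
  refine ⟨mem_H10_iff.2 ⟨fun i => ⟨_, hw i⟩, fun ε hε => ?_⟩, funext hgrad⟩
  have e1 := (tendsto_iff_norm_sub_tendsto_zero.1 h1).eventually (gt_mem_nhds hε)
  have e2 : ∀ᶠ n in Filter.atTop, ∀ i, ‖((hφ n).pderiv i).toL2 - g i‖ < ε :=
    Filter.eventually_all.2 fun i =>
      (tendsto_iff_norm_sub_tendsto_zero.1 (h2 i)).eventually (gt_mem_nhds hε)
  obtain ⟨n, hn1, hn2⟩ := (e1.and e2).exists
  refine ⟨φ n, hφ n, by rwa [norm_sub_rev], fun i => ?_⟩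
  rw [norm_sub_rev, hgrad]
  exact hn2 i

/-- Green's formula without boundary terms, for one factor in `H¹₀(Ω)` and the other in
`H¹(Ω)`. -/
theorem inner_weakDeriv_of_mem_H10 {f v : L2 Ω} (hf : f ∈ H1 Ω) (hv : v ∈ H10 Ω) (i : Fin 2) :
    inner ℝ v (weakDeriv Ω i f) = -inner ℝ (weakDeriv Ω i v) f := by
  obtain ⟨φ, hφ, h1, h2⟩ := exists_seq_of_mem_H10 hv
  refine tendsto_nhds_unique (h1.inner (𝕜 := ℝ) tendsto_const_nhds) ?_
  refine ((h2 i).inner (𝕜 := ℝ) (tendsto_const_nhds (x := f))).neg.congr fun n => ?_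
  rw [real_inner_comm, hasWeakDeriv_iff.1 (hasWeakDeriv_weakDeriv hf i) _ (hφ n), neg_neg,
    real_inner_comm]

/-- The rotated gradient of an `H¹₀(Ω)` function is orthogonal to the gradients of `H¹(Ω)`. -/
theorem inner_grad_comm_of_mem_H10 {f v : L2 Ω} (hf : f ∈ H1 Ω) (hv : v ∈ H10 Ω) (i j : Fin 2) :
    inner ℝ (weakDeriv Ω i v) (weakDeriv Ω j f) =
      (inner ℝ (weakDeriv Ω j v) (weakDeriv Ω i f) : ℝ) := by
  obtain ⟨φ, hφ, -, h2⟩ := exists_seq_of_mem_H10 hv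
  refine tendsto_nhds_unique ((h2 i).inner (𝕜 := ℝ) tendsto_const_nhds) ?_
  refine ((h2 j).inner (𝕜 := ℝ) (tendsto_const_nhds (x := weakDeriv Ω i f))).congr fun n => ?_
  have key : ∀ a b : Fin 2, inner ℝ ((hφ n).pderiv a).toL2 (weakDeriv Ω b f) =
      -(inner ℝ f (((hφ n).pderiv a).pderiv b).toL2 : ℝ) := by
    intro a b
    rw [hasWeakDeriv_iff.1 (hasWeakDeriv_weakDeriv hf b) _ ((hφ n).pderiv a), neg_neg,
      real_inner_comm]
  rw [key, key, IsTest.toL2_congr _ _ ((hφ n).pderiv_comm i j)]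

/-! ### The Poincaré inequality and the closed space of gradients -/

/-- The Poincaré inequality, from `∫ φ² = -2 ∫ x₀ φ ∂₀φ`. -/
theorem exists_norm_le_pderiv (hΩ : IsOpen Ω) (hb : Bornology.IsBounded Ω) :
    ∃ R : ℝ, ∀ (φ : Plane → ℝ) (hφ : IsTest Ω φ), ‖hφ.toL2‖ ≤ R * ‖(hφ.pderiv 0).toL2‖ := by
  obtain ⟨R, hR⟩ := hb.exists_norm_le
  have hcoord : ∀ x ∈ Ω, |x 0| ≤ |R| := fun x hx =>
    (PiLp.norm_apply_le x 0).trans ((hR x hx).trans (le_abs_self R))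
  refine ⟨2 * |R|, fun φ hφ => ?_⟩
  have hxd : ∀ x : Plane, HasFDerivAt (fun y : Plane => y 0)
      (EuclideanSpace.proj (0 : Fin 2) : Plane →L[ℝ] ℝ) x := fun x =>
    (EuclideanSpace.proj (0 : Fin 2) : Plane →L[ℝ] ℝ).hasFDerivAt
  have hd : ∀ x : Plane, HasFDerivAt (fun y : Plane => y 0 * φ y)
      (x 0 • fderiv ℝ φ x + φ x • (EuclideanSpace.proj (0 : Fin 2) : Plane →L[ℝ] ℝ)) x :=
    fun x => (hxd x).mul (hφ.differentiable x).hasFDerivAt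
  have hc0 : Continuous fun y : Plane => y 0 :=
    (EuclideanSpace.proj (0 : Fin 2) : Plane →L[ℝ] ℝ).continuous
  have hibp := hφ.setIntegral_mul_pderiv hΩ (fun x _ => hd x)
    (((hc0.smul (hφ.smooth.continuous_fderiv (by simp))).add
      (hφ.continuous.smul continuous_const)).continuousOn) 0
  have hsq : ∀ x : Plane, (x 0 • fderiv ℝ φ x + φ x • (EuclideanSpace.proj (0 : Fin 2) :
      Plane →L[ℝ] ℝ)) (EuclideanSpace.single 0 1) * φ x =
      x 0 * φ x * pderiv 0 φ x + φ x * φ x := by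
    intro x
    simp [StreamFunction.pderiv]
    ring
  have hi1 : Integrable (fun x => x 0 * φ x * pderiv 0 φ x) (volume.restrict Ω) :=
    ((hφ.pderiv 0).integrable_continuousOn_mul hΩ
      (hc0.mul hφ.continuous).continuousOn).restrict
  have hi2 : Integrable (fun x => φ x * φ x) (volume.restrict Ω) :=
    (hφ.integrable_continuousOn_mul hΩ hφ.continuous.continuousOn).restrict
  simp_rw [hsq] at hibp
  rw [integral_add hi1 hi2] at hibp
  have hn : ‖hφ.toL2‖ ^ 2 = ∫ x in Ω, φ x * φ x := by
    rw [← real_inner_self_eq_norm_sq, inner_toL2]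
    refine integral_congr_ae ?_
    filter_upwards [hφ.coeFn_toL2] with x hx
    rw [hx]
  have habs : |∫ x in Ω, x 0 * φ x * pderiv 0 φ x| ≤
      |R| * (‖hφ.toL2‖ * ‖(hφ.pderiv 0).toL2‖) := by
    have hm : Integrable (fun x => |φ x| * |pderiv 0 φ x|) (volume.restrict Ω) := by
      have := ((hφ.pderiv 0).integrable_continuousOn_mul hΩ
        hφ.continuous.continuousOn).restrict (s := Ω)
      simpa [abs_mul] using this.abs
    have hA : |∫ x in Ω, x 0 * φ x * pderiv 0 φ x| ≤
        ∫ x in Ω, |R| * (|φ x| * |pderiv 0 φ x|) := by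
      refine abs_integral_le_integral_abs.trans ?_
      refine setIntegral_mono_on hi1.abs (hm.const_mul _) hΩ.measurableSet fun x hx => ?_
      rw [abs_mul, abs_mul, mul_assoc]
      exact mul_le_mul_of_nonneg_right (hcoord x hx) (by positivity)
    refine hA.trans ?_
    rw [integral_const_mul]
    refine mul_le_mul_of_nonneg_left ?_ (abs_nonneg R)
    have hab : ∫ x in Ω, |φ x| * |pderiv 0 φ x| =
        inner ℝ |hφ.toL2| |(hφ.pderiv 0).toL2| := by
      rw [inner_eq_integral]
      refine integral_congr_ae ?_
      filter_upwards [hφ.coeFn_toL2, (hφ.pderiv 0).coeFn_toL2, Lp.coeFn_abs hφ.toL2,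
        Lp.coeFn_abs (hφ.pderiv 0).toL2] with x h1 h2 h3 h4
      rw [h3, h4, h1, h2]
    rw [hab]
    simpa only [norm_abs_eq_norm] using real_inner_le_norm |hφ.toL2| |(hφ.pderiv 0).toL2|
  have hfin : ‖hφ.toL2‖ * ‖hφ.toL2‖ ≤ (2 * |R| * ‖(hφ.pderiv 0).toL2‖) * ‖hφ.toL2‖ := by
    have := neg_le_abs (∫ x in Ω, x 0 * φ x * pderiv 0 φ x)
    nlinarith
  rcases (norm_nonneg hφ.toL2).eq_or_lt with h0 | h0
  · rw [← h0]; positivity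
  · exact le_of_mul_le_mul_right hfin h0

theorem exists_norm_sub_le_pderiv (hΩ : IsOpen Ω) (hb : Bornology.IsBounded Ω) :
    ∃ R : ℝ, ∀ (φ χ : Plane → ℝ) (hφ : IsTest Ω φ) (hχ : IsTest Ω χ),
      ‖hφ.toL2 - hχ.toL2‖ ≤ R * ‖(hφ.pderiv 0).toL2 - (hχ.pderiv 0).toL2‖ := by
  obtain ⟨R, hR⟩ := exists_norm_le_pderiv hΩ hb
  refine ⟨R, fun φ χ hφ hχ => ?_⟩
  have h := hR _ (hφ.sub hχ)
  rwa [IsTest.toL2_congr ((hφ.sub hχ).pderiv 0) ((hφ.pderiv 0).sub (hχ.pderiv 0))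
    (hφ.pderiv_sub hχ 0)] at h

/-- The Hilbert space `L²(Ω)²`. -/
abbrev L2Field (Ω : Set Plane) : Type := PiLp 2 fun _ : Fin 2 => L2 Ω

theorem norm_toLp_eq_normH (v : Fin 2 → L2 Ω) : ‖(WithLp.toLp 2 v : L2Field Ω)‖ = normH v := by
  rw [PiLp.norm_eq_of_L2, normH]

/-- The closure in `L²(Ω)²` of the gradients of the test functions. -/
def gradSpace (Ω : Set Plane) : Submodule ℝ (L2Field Ω) :=
  Submodule.topologicalClosure
    { carrier := {k | ∃ (φ : Plane → ℝ) (hφ : IsTest Ω φ),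
        k = WithLp.toLp 2 fun i => (hφ.pderiv i).toL2}
      add_mem' := by
        rintro _ _ ⟨φ, hφ, rfl⟩ ⟨χ, hχ, rfl⟩
        refine ⟨_, hφ.add hχ, ?_⟩
        rw [← WithLp.toLp_add]
        congr 1
        funext i
        exact (((hφ.add hχ).pderiv i).toL2_congr ((hφ.pderiv i).add (hχ.pderiv i))
          (hφ.pderiv_add hχ i)).symm
      zero_mem' := by
        refine ⟨0, isTest_zero, ?_⟩
        rw [← WithLp.toLp_zero]
        congr 1
        funext i
        have h0 : pderiv i (0 : Plane → ℝ) = 0 := by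
          funext x; simp [pderiv]
        exact ((isTest_zero.pderiv i).toL2_congr isTest_zero h0).symm
      smul_mem' := by
        rintro c _ ⟨φ, hφ, rfl⟩
        refine ⟨_, hφ.const_smul c, ?_⟩
        rw [← WithLp.toLp_smul]
        congr 1
        funext i
        exact (((hφ.const_smul c).pderiv i).toL2_congr ((hφ.pderiv i).const_smul c)
          (hφ.pderiv_const_smul c i)).symm }

theorem IsTest.grad_mem_gradSpace (hφ : IsTest Ω φ) :
    (WithLp.toLp 2 fun i => (hφ.pderiv i).toL2) ∈ gradSpace Ω :=
  Submodule.le_topologicalClosure _ ⟨φ, hφ, rfl⟩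

theorem grad_mem_gradSpace {f : L2 Ω} (hf : f ∈ H10 Ω) :
    WithLp.toLp 2 (grad Ω f) ∈ gradSpace Ω := by
  obtain ⟨φ, hφ, -, h2⟩ := exists_seq_of_mem_H10 hf
  have hlim : Filter.Tendsto (fun n => (WithLp.toLp 2 fun i => ((hφ n).pderiv i).toL2 : L2Field Ω))
      Filter.atTop (nhds (WithLp.toLp 2 (grad Ω f))) :=
    (PiLp.continuous_toLp 2 _).continuousAt.tendsto.comp (tendsto_pi_nhds.2 h2)
  exact (Submodule.isClosed_topologicalClosure _).mem_of_tendsto hlim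
    (Filter.Eventually.of_forall fun n => (hφ n).grad_mem_gradSpace)

/-- By the Poincaré inequality, every limit of gradients of test functions is the gradient of a
function in `H¹₀(Ω)`. -/
theorem exists_grad_eq_of_mem_gradSpace (hΩ : IsOpen Ω) (hb : Bornology.IsBounded Ω)
    {k : L2Field Ω} (hk : k ∈ gradSpace Ω) : ∃ f ∈ H10 Ω, grad Ω f = k.ofLp := by
  obtain ⟨R, hR⟩ := exists_norm_sub_le_pderiv hΩ hb
  obtain ⟨s, hs, hlim⟩ := mem_closure_iff_seq_limit.1 hk
  choose φ hφ hsφ using hs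
  obtain rfl : s = fun n => WithLp.toLp 2 fun i => ((hφ n).pderiv i).toL2 := funext hsφ
  have hcomp : ∀ i, Filter.Tendsto (fun n => ((hφ n).pderiv i).toL2) Filter.atTop
      (nhds (k.ofLp i)) := fun i =>
    ((continuous_apply i).comp (PiLp.continuous_ofLp 2 _)).continuousAt.tendsto.comp hlim
  have hcau : CauchySeq fun n => (hφ n).toL2 := by
    have hR' : 0 < |R| + 1 := by positivity
    rw [Metric.cauchySeq_iff']
    intro ε hε
    obtain ⟨N, hN⟩ := Metric.cauchySeq_iff'.1 (hcomp 0).cauchySeq (ε / (|R| + 1)) (by positivity)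
    refine ⟨N, fun n hn => ?_⟩
    have h1 := hN n hn
    rw [dist_eq_norm, lt_div_iff₀ hR'] at h1
    rw [dist_eq_norm]
    refine (hR _ _ (hφ n) (hφ N)).trans_lt (lt_of_le_of_lt ?_ h1)
    rw [mul_comm]
    exact mul_le_mul_of_nonneg_left ((le_abs_self R).trans (by linarith)) (norm_nonneg _)
  obtain ⟨f, hf⟩ := cauchySeq_tendsto_of_complete hcau
  obtain ⟨h1, h2⟩ := mem_H10_of_tendsto hΩ (g := k.ofLp) hφ hf hcomp
  exact ⟨f, h1, h2⟩

/-- A function in `H¹₀(Ω)` is determined by its gradient. -/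
theorem eq_of_grad_eq (hΩ : IsOpen Ω) (hb : Bornology.IsBounded Ω) {f f' : L2 Ω}
    (hf : f ∈ H10 Ω) (hf' : f' ∈ H10 Ω) (h : grad Ω f = grad Ω f') : f = f' := by
  obtain ⟨R, hR⟩ := exists_norm_sub_le_pderiv hΩ hb
  obtain ⟨φ, hφ, h1, h2⟩ := exists_seq_of_mem_H10 hf
  obtain ⟨χ, hχ, h1', h2'⟩ := exists_seq_of_mem_H10 hf'
  have h0 : weakDeriv Ω 0 f = weakDeriv Ω 0 f' := congrFun h 0
  have hle : ‖f - f'‖ ≤ R * ‖weakDeriv Ω 0 f - weakDeriv Ω 0 f'‖ := by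
    refine le_of_tendsto_of_tendsto' (h1.sub h1').norm
      (((h2 0).sub (h2' 0)).norm.const_mul R) fun n =>
        hR _ _ (hφ n) (hχ n)
  rw [h0, sub_self, norm_zero, mul_zero] at hle
  exact sub_eq_zero.1 (norm_le_zero_iff.1 hle)

/-! ### A radial mollifier -/

/-- A smooth bump supported in the closed unit disc. It depends on `‖z‖` only, which is what makes
the mollification of a harmonic field independent of the scale. -/
def radialBump (z : Plane) : ℝ := Real.smoothTransition (1 - ‖z‖ ^ 2)

theorem contDiff_radialBump : ContDiff ℝ ∞ radialBump :=
  (Real.smoothTransition.contDiff (n := ⊤)).comp (contDiff_const.sub (contDiff_norm_sq ℝ))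

theorem radialBump_eq_zero {z : Plane} (hz : 1 ≤ ‖z‖) : radialBump z = 0 :=
  Real.smoothTransition.zero_of_nonpos (by nlinarith)

theorem radialBump_nonneg (z : Plane) : 0 ≤ radialBump z := Real.smoothTransition.nonneg _

theorem radialBump_le_one (z : Plane) : radialBump z ≤ 1 := Real.smoothTransition.le_one _

theorem tsupport_radialBump : tsupport radialBump ⊆ Metric.closedBall 0 1 := by
  refine closure_minimal (fun z hz => ?_) Metric.isClosed_closedBall
  rw [mem_closedBall_zero_iff]
  by_contra h
  exact hz (radialBump_eq_zero (not_le.1 h).le)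

theorem hasCompactSupport_radialBump : HasCompactSupport radialBump :=
  (isCompact_closedBall (0 : Plane) 1).of_isClosed_subset (isClosed_tsupport _)
    tsupport_radialBump

theorem integral_radialBump_pos : 0 < ∫ z, radialBump z :=
  contDiff_radialBump.continuous.integral_pos_of_hasCompactSupport_nonneg_nonzero
    hasCompactSupport_radialBump radialBump_nonneg (x := 0)
    (by simp [radialBump, Real.smoothTransition.one_of_one_le])

theorem pderiv_radialBump (i : Fin 2) (z : Plane) :
    pderiv i radialBump z = deriv Real.smoothTransition (1 - ‖z‖ ^ 2) * (-(2 * z i)) := by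
  have h1 : HasFDerivAt (fun z : Plane => 1 - ‖z‖ ^ 2) (-(2 • innerSL ℝ z)) z :=
    (hasStrictFDerivAt_norm_sq z).hasFDerivAt.const_sub 1
  have h2 : HasDerivAt Real.smoothTransition (deriv Real.smoothTransition (1 - ‖z‖ ^ 2))
      (1 - ‖z‖ ^ 2) :=
    ((Real.smoothTransition.contDiff (n := ⊤)).differentiable (by simp) _).hasDerivAt
  have h3 : HasFDerivAt radialBump _ z := h2.comp_hasFDerivAt z h1
  rw [pderiv, h3.fderiv]
  simp [EuclideanSpace.inner_single_right]

/-- The components `zᵢ B(z)` of the radial field with divergence `2 B(z) + DB(z) z`. -/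
def radialField (i : Fin 2) (z : Plane) : ℝ := z i * radialBump z

theorem contDiff_coord (i : Fin 2) : ContDiff ℝ ∞ fun z : Plane => z i :=
  (EuclideanSpace.proj i : Plane →L[ℝ] ℝ).contDiff

theorem contDiff_radialField (i : Fin 2) : ContDiff ℝ ∞ (radialField i) :=
  (contDiff_coord i).mul contDiff_radialBump

theorem tsupport_radialField (i : Fin 2) : tsupport (radialField i) ⊆ Metric.closedBall 0 1 :=
  (tsupport_mul_subset_right (f := fun z : Plane => z i)).trans tsupport_radialBump

theorem pderiv_radialField (i j : Fin 2) (z : Plane) :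
    pderiv j (radialField i) z =
      (if i = j then radialBump z else 0) + z i * pderiv j radialBump z := by
  have h1 : HasFDerivAt (fun z : Plane => z i) (EuclideanSpace.proj i : Plane →L[ℝ] ℝ) z :=
    (EuclideanSpace.proj i : Plane →L[ℝ] ℝ).hasFDerivAt
  have h2 := (contDiff_radialBump.differentiable (by simp) z).hasFDerivAt
  have h3 : HasFDerivAt (radialField i) _ z := h1.mul h2
  rw [pderiv, h3.fderiv]
  by_cases hij : i = j
  · subst hij; simp [pderiv]; ring
  · simp [pderiv, hij]

theorem clm_apply_eq_sum (L : Plane →L[ℝ] ℝ) (v : Plane) :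
    L v = v 0 * L (EuclideanSpace.single 0 1) + v 1 * L (EuclideanSpace.single 1 1) := by
  have hv : v = v 0 • EuclideanSpace.single 0 1 + v 1 • EuclideanSpace.single 1 1 := by
    ext k; fin_cases k <;> simp
  conv_lhs => rw [hv]
  simp

theorem fderiv_apply_eq_sum (f : Plane → ℝ) (x v : Plane) :
    fderiv ℝ f x v = v 0 * pderiv 0 f x + v 1 * pderiv 1 f x :=
  clm_apply_eq_sum _ v

/-- The divergence of the radial field. -/
def radialDiv (z : Plane) : ℝ := 2 * radialBump z + fderiv ℝ radialBump z z

theorem radialDiv_eq (z : Plane) :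
    radialDiv z = pderiv 0 (radialField 0) z + pderiv 1 (radialField 1) z := by
  rw [radialDiv, fderiv_apply_eq_sum, pderiv_radialField, pderiv_radialField]
  simp; ring

theorem continuous_radialDiv : Continuous radialDiv :=
  (contDiff_radialBump.continuous.const_mul 2).add
    ((contDiff_radialBump.continuous_fderiv (by simp)).clm_apply continuous_id)

theorem exists_abs_radialDiv_le : ∃ C : ℝ, ∀ z, |radialDiv z| ≤ C := by
  have hs : HasCompactSupport radialDiv := by
    refine HasCompactSupport.intro (isCompact_closedBall (0 : Plane) 1) fun z hz => ?_
    have h1 : z ∉ tsupport radialBump := fun h => hz (tsupport_radialBump h)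
    rw [radialDiv, image_eq_zero_of_notMem_tsupport h1,
      image_eq_zero_of_notMem_tsupport fun h => h1 (tsupport_fderiv_subset ℝ h)]
    simp
  exact hs.exists_bound_of_continuous continuous_radialDiv

theorem isTest_comp_smul_sub {K : Plane → ℝ} (hK : ContDiff ℝ ∞ K)
    (hs : tsupport K ⊆ Metric.closedBall 0 1) {x : Plane} {t : ℝ} (ht : 0 < t)
    (hx : Metric.closedBall x t⁻¹ ⊆ Ω) : IsTest Ω fun y => K (t • (x - y)) := by
  have hsub : tsupport (fun y => K (t • (x - y))) ⊆ Metric.closedBall x t⁻¹ := by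
    refine closure_minimal (fun y hy => ?_) Metric.isClosed_closedBall
    have h1 : t • (x - y) ∈ Metric.closedBall (0 : Plane) 1 := hs (subset_tsupport _ hy)
    rw [mem_closedBall_zero_iff, norm_smul, Real.norm_of_nonneg ht.le] at h1
    rw [Metric.mem_closedBall, dist_comm, dist_eq_norm, ← one_div, le_div_iff₀ ht, mul_comm]
    exact h1
  exact ⟨hK.comp ((contDiff_const.sub contDiff_id).const_smul t),
    (isCompact_closedBall x t⁻¹).of_isClosed_subset (isClosed_tsupport _) hsub, hsub.trans hx⟩

theorem pderiv_comp_smul_sub {K : Plane → ℝ} (hK : ContDiff ℝ ∞ K) (x y : Plane) (t : ℝ)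
    (i : Fin 2) : pderiv i (fun y => K (t • (x - y))) y = -(t * pderiv i K (t • (x - y))) := by
  have h1 : HasFDerivAt (fun y : Plane => t • (x - y)) (t • -ContinuousLinearMap.id ℝ Plane) y :=
    ((hasFDerivAt_id y).const_sub x).const_smul t
  have h2 := (hK.differentiable (by simp) (t • (x - y))).hasFDerivAt.comp y h1
  rw [pderiv, show (fun y => K (t • (x - y))) = K ∘ fun y => t • (x - y) from rfl, h2.fderiv]
  simp [pderiv]

/-! ### Weyl's lemma for fields that are weakly divergence free and curl free -/

/-- The pair `p, q` satisfies weakly the Cauchy-Riemann equations `∂₀p + ∂₁q = 0` and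
`∂₁p = ∂₀q`: the field `(p, q)` is divergence free and curl free. -/
structure IsHarmonicField (p q : L2 Ω) : Prop where
  div_free : ∀ (χ : Plane → ℝ) (hχ : IsTest Ω χ),
    inner ℝ p (hχ.pderiv 0).toL2 = -(inner ℝ q (hχ.pderiv 1).toL2 : ℝ)
  curl_free : ∀ (χ : Plane → ℝ) (hχ : IsTest Ω χ),
    inner ℝ p (hχ.pderiv 1).toL2 = (inner ℝ q (hχ.pderiv 0).toL2 : ℝ)

theorem IsHarmonicField.rotate {p q : L2 Ω} (h : IsHarmonicField p q) :
    IsHarmonicField q (-p) where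
  div_free χ hχ := by rw [inner_neg_left, neg_neg, h.curl_free χ hχ]
  curl_free χ hχ := by rw [inner_neg_left, h.div_free χ hχ, neg_neg]

theorem isFiniteMeasure_restrict_of_isBounded (hb : Bornology.IsBounded Ω) :
    IsFiniteMeasure (volume.restrict Ω) :=
  ⟨by simpa using hb.measure_lt_top⟩

theorem integrable_of_L2 (hb : Bornology.IsBounded Ω) (p : L2 Ω) :
    Integrable p (volume.restrict Ω) :=
  have := isFiniteMeasure_restrict_of_isBounded hb
  (Lp.memLp p).integrable (by norm_num)

/-- The divergence of the rescaled radial field is orthogonal to each component of a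
divergence free and curl free field, because the curl of the radial field vanishes. -/
theorem IsHarmonicField.setIntegral_mul_radialDiv {p q : L2 Ω} (h : IsHarmonicField p q)
    {x : Plane} {t : ℝ} (ht : 0 < t) (hx : Metric.closedBall x t⁻¹ ⊆ Ω) :
    ∫ y in Ω, p y * (t * radialDiv (t • (x - y))) = 0 := by
  have hT : ∀ i, IsTest Ω fun y => radialField i (t • (x - y)) := fun i =>
    isTest_comp_smul_sub (contDiff_radialField i) (tsupport_radialField i) ht hx
  have hint : ∀ (f : L2 Ω) (i j : Fin 2), Integrable
      (fun y => f y * pderiv j (fun y => radialField i (t • (x - y))) y)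
      (volume.restrict Ω) := by
    intro f i j
    refine (integrable_mul f ((hT i).pderiv j).toL2).congr ?_
    filter_upwards [((hT i).pderiv j).coeFn_toL2] with y hy
    rw [hy]
  have e1 : ∫ y in Ω, p y * (t * radialDiv (t • (x - y))) =
      -(inner ℝ p ((hT 0).pderiv 0).toL2 + inner ℝ p ((hT 1).pderiv 1).toL2) := by
    rw [inner_toL2, inner_toL2, ← integral_add (hint p 0 0) (hint p 1 1), ← integral_neg]
    refine integral_congr_ae (Filter.Eventually.of_forall fun y => ?_)
    simp only [pderiv_comp_smul_sub (contDiff_radialField _), radialDiv_eq]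
    ring
  have e2 : (inner ℝ q ((hT 1).pderiv 0).toL2 : ℝ) = inner ℝ q ((hT 0).pderiv 1).toL2 := by
    rw [inner_toL2, inner_toL2]
    refine integral_congr_ae (Filter.Eventually.of_forall fun y => ?_)
    simp only [pderiv_comp_smul_sub (contDiff_radialField _), pderiv_radialField,
      pderiv_radialBump]
    simp
    ring_nf
    simp
  rw [e1, h.div_free _ (hT 0), h.curl_free _ (hT 1), e2]
  ring

/-- The mollification of a component of a divergence free and curl free field does not depend on
the scale of the mollifier. -/
theorem IsHarmonicField.mollify_eq (hb : Bornology.IsBounded Ω) {p q : L2 Ω}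
    (h : IsHarmonicField p q) {x : Plane} {r : ℝ} (hr : 0 < r)
    (hx : Metric.closedBall x r ⊆ Ω) {s t : ℝ} (hs : r⁻¹ < s) (ht : r⁻¹ < t) :
    ∫ y in Ω, p y * (s ^ 2 * radialBump (s • (x - y))) =
      ∫ y in Ω, p y * (t ^ 2 * radialBump (t • (x - y))) := by
  obtain ⟨C, hC⟩ := exists_abs_radialDiv_le
  have hpi := integrable_of_L2 hb p
  have hpos : ∀ t ∈ Set.Ioi r⁻¹, 0 < t := fun t ht => (inv_pos.2 hr).trans ht
  have hD : ∀ t ∈ Set.Ioi r⁻¹,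
      HasDerivAt (fun t => ∫ y in Ω, p y * (t ^ 2 * radialBump (t • (x - y)))) 0 t := by
    intro t ht
    have ht0 := hpos t ht
    have hball : Metric.closedBall x t⁻¹ ⊆ Ω :=
      (Metric.closedBall_subset_closedBall (inv_le_of_inv_le₀ hr ht.le)).trans hx
    rw [← h.setIntegral_mul_radialDiv ht0 hball]
    have hcont : ∀ τ : ℝ, Continuous fun y : Plane => τ • (x - y) := fun τ =>
      (continuous_const.sub continuous_id).const_smul τ
    have hbump : ∀ τ : ℝ, Integrable (fun y => p y * (τ ^ 2 * radialBump (τ • (x - y))))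
        (volume.restrict Ω) := by
      intro τ
      refine hpi.mul_bdd (c := τ ^ 2) ?_ (Filter.Eventually.of_forall fun y => ?_)
      · exact (continuous_const.mul
          (contDiff_radialBump.continuous.comp (hcont τ))).aestronglyMeasurable
      · rw [norm_mul, Real.norm_of_nonneg (sq_nonneg τ),
          Real.norm_of_nonneg (radialBump_nonneg _)]
        exact mul_le_of_le_one_right (sq_nonneg τ) (radialBump_le_one _)
    refine (hasDerivAt_integral_of_dominated_loc_of_deriv_le
      (s := Set.Ioo 0 (2 * t)) (bound := fun y => |p y| * (2 * t * C))
      (F' := fun τ y => p y * (τ * radialDiv (τ • (x - y))))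
      (Ioo_mem_nhds ht0 (by linarith)) (Filter.Eventually.of_forall fun τ =>
        (hbump τ).aestronglyMeasurable) (hbump t) ?_ ?_ ?_ ?_).2
    · exact hpi.aestronglyMeasurable.mul (continuous_const.mul
        (continuous_radialDiv.comp (hcont t))).aestronglyMeasurable
    · refine Filter.Eventually.of_forall fun y τ hτ => ?_
      rw [Real.norm_eq_abs, abs_mul, abs_mul, abs_of_pos hτ.1]
      exact mul_le_mul_of_nonneg_left (mul_le_mul hτ.2.le (hC _) (abs_nonneg _) (by linarith))
        (abs_nonneg _)
    · exact hpi.abs.mul_const _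
    · refine Filter.Eventually.of_forall fun y τ _ => ?_
      have h1 : HasDerivAt (fun τ : ℝ => τ • (x - y)) ((1 : ℝ) • (x - y)) τ :=
        (hasDerivAt_id τ).smul_const (x - y)
      have h2 := (contDiff_radialBump.differentiable (by simp)
        (τ • (x - y))).hasFDerivAt.comp_hasDerivAt τ h1
      have h3 := (((hasDerivAt_id τ).pow 2).mul h2).const_mul (p y)
      convert! h3 using 1
      simp only [radialDiv, Pi.pow_apply, Function.comp_apply, map_smul, one_smul, smul_eq_mul,
        id_eq]
      push_cast
      ring
  exact isOpen_Ioi.is_const_of_deriv_eq_zero isPreconnected_Ioi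
    (fun t ht => (hD t ht).differentiableAt.differentiableWithinAt)
    (fun t ht => (hD t ht).deriv) hs ht

/-- Lebesgue differentiation for the radial mollifier. -/
theorem ae_tendsto_mollify {f : Plane → ℝ} (hf : Integrable f) :
    ∀ᵐ x, Filter.Tendsto
      (fun t : ℝ => ∫ y, f y * ((∫ z, radialBump z)⁻¹ * (t ^ 2 * radialBump (t • (x - y)))))
      Filter.atTop (nhds (f x)) := by
  have hc := integral_radialBump_pos
  set c := ∫ z, radialBump z with hcdef
  filter_upwards [(Besicovitch.vitaliFamily (volume : Measure Plane)).ae_tendsto_average_norm_sub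
    hf.locallyIntegrable] with x hx
  have hinv : Filter.Tendsto (fun t : ℝ => t⁻¹) Filter.atTop (nhdsWithin 0 (Set.Ioi 0)) :=
    tendsto_inv_atTop_nhdsGT_zero
  have h0 := (hx.comp (Besicovitch.tendsto_filterAt volume x)).comp hinv
  have := tendsto_integral_smul_of_tendsto_average_norm_sub
    (g := fun (t : ℝ) y => c⁻¹ * (t ^ 2 * radialBump (t • (x - y))))
    (c⁻¹ * (volume : Measure Plane).real (Metric.ball 0 1)) h0
    (Filter.Eventually.of_forall fun t => hf.integrableOn) ?_ ?_ ?_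
  · simpa [mul_comm] using this
  · refine tendsto_const_nhds.congr' ?_
    filter_upwards [Filter.eventually_gt_atTop 0] with t ht
    rw [integral_const_mul, integral_const_mul,
      integral_sub_left_eq_self (fun z : Plane => radialBump (t • z)),
      Measure.integral_comp_smul]
    rw [← hcdef, finrank_euclideanSpace_fin, abs_of_pos (by positivity), smul_eq_mul]
    field_simp
  · filter_upwards [Filter.eventually_gt_atTop 0] with t ht y hy
    rw [Metric.mem_closedBall, dist_comm, dist_eq_norm, ← one_div, le_div_iff₀ ht, mul_comm]
    by_contra hlt
    refine hy ?_
    have : radialBump (t • (x - y)) = 0 := radialBump_eq_zero (by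
      rw [norm_smul, Real.norm_of_nonneg ht.le]; exact (not_le.1 hlt).le)
    simp [this]
  · filter_upwards [Filter.eventually_gt_atTop 0] with t ht y
    rw [Measure.addHaar_real_closedBall _ _ (inv_nonneg.2 ht.le), finrank_euclideanSpace_fin]
    have hv : 0 < (volume : Measure Plane).real (Metric.ball 0 1) :=
      ENNReal.toReal_pos (Metric.measure_ball_pos _ _ one_pos).ne' measure_ball_lt_top.ne
    have he : c⁻¹ * (volume : Measure Plane).real (Metric.ball 0 1) /
        (t⁻¹ ^ 2 * (volume : Measure Plane).real (Metric.ball 0 1)) = c⁻¹ * (t ^ 2 * 1) := by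
      field_simp
    rw [he, abs_of_nonneg (mul_nonneg (inv_nonneg.2 hc.le)
      (mul_nonneg (sq_nonneg t) (radialBump_nonneg _)))]
    have h1 := radialBump_le_one (t • (x - y))
    gcongr

/-- The radial bump, rescaled to the disc of radius `t⁻¹` and normalized to integral one. -/
def mollifyKernel (t : ℝ) (z : Plane) : ℝ :=
  (∫ z, radialBump z)⁻¹ * (t ^ 2 * radialBump (t • z))

/-- The mollification of `p`, extended by zero outside `Ω`, at the scale `t⁻¹`. -/
def mollify (Ω : Set Plane) (p : L2 Ω) (t : ℝ) (x : Plane) : ℝ :=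
  ∫ y in Ω, p y * mollifyKernel t (x - y)

theorem contDiff_mollifyKernel (t : ℝ) : ContDiff ℝ ∞ (mollifyKernel t) :=
  contDiff_const.mul (contDiff_const.mul (contDiff_radialBump.comp (contDiff_id.const_smul t)))

theorem hasCompactSupport_mollifyKernel {t : ℝ} (ht : 0 < t) :
    HasCompactSupport (mollifyKernel t) := by
  refine HasCompactSupport.intro (isCompact_closedBall (0 : Plane) t⁻¹) fun z hz => ?_
  rw [mem_closedBall_zero_iff, not_le, ← one_div, div_lt_iff₀ ht, mul_comm] at hz
  have : radialBump (t • z) = 0 := radialBump_eq_zero (by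
    rw [norm_smul, Real.norm_of_nonneg ht.le]; exact hz.le)
  simp [mollifyKernel, this]

theorem integrable_indicator_L2 (hΩ : IsOpen Ω) (hb : Bornology.IsBounded Ω) (p : L2 Ω) :
    Integrable (Ω.indicator p) :=
  (integrable_indicator_iff hΩ.measurableSet).2 (integrable_of_L2 hb p)

theorem setIntegral_mul_eq_indicator (hΩ : IsOpen Ω) (p : L2 Ω) (k : Plane → ℝ) :
    ∫ y in Ω, p y * k y = ∫ y, Ω.indicator p y * k y := by
  rw [← integral_indicator hΩ.measurableSet]
  congr 1
  funext y
  by_cases hy : y ∈ Ω <;> simp [hy]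

theorem mollify_eq_convolution (hΩ : IsOpen Ω) (p : L2 Ω) (t : ℝ) :
    mollify Ω p t = convolution (Ω.indicator p) (mollifyKernel t)
      (ContinuousLinearMap.mul ℝ ℝ) volume := by
  funext x
  rw [mollify, setIntegral_mul_eq_indicator hΩ, convolution_def]
  rfl

theorem contDiff_mollify (hΩ : IsOpen Ω) (hb : Bornology.IsBounded Ω) (p : L2 Ω) {t : ℝ}
    (ht : 0 < t) : ContDiff ℝ ∞ (mollify Ω p t) := by
  rw [mollify_eq_convolution hΩ]
  exact (hasCompactSupport_mollifyKernel ht).contDiff_convolution_right (n := ⊤) _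
    (integrable_indicator_L2 hΩ hb p).locallyIntegrable (contDiff_mollifyKernel t)

theorem pderiv_mollify (hΩ : IsOpen Ω) (hb : Bornology.IsBounded Ω) (p : L2 Ω) {t : ℝ}
    (ht : 0 < t) (i : Fin 2) (x : Plane) :
    pderiv i (mollify Ω p t) x = ∫ y in Ω, p y * pderiv i (mollifyKernel t) (x - y) := by
  have hloc := (integrable_indicator_L2 hΩ hb p).locallyIntegrable
  have hk := hasCompactSupport_mollifyKernel ht
  have hc1 : ContDiff ℝ 1 (mollifyKernel t) := (contDiff_mollifyKernel t).of_le (by simp)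
  have hd := hk.hasFDerivAt_convolution_right (ContinuousLinearMap.mul ℝ ℝ) hloc hc1 x
  rw [← mollify_eq_convolution hΩ] at hd
  rw [pderiv, hd.fderiv, setIntegral_mul_eq_indicator hΩ, convolution_def]
  rw [ContinuousLinearMap.integral_apply]
  · rfl
  · exact (hk.fderiv (𝕜 := ℝ)).convolutionExists_right
      (L := ContinuousLinearMap.precompR Plane (ContinuousLinearMap.mul ℝ ℝ)) hloc
      (hc1.continuous_fderiv (by simp)) x

/-- Weyl's lemma: near each point of `Ω` a divergence free and curl free field agrees almost
everywhere with its mollification at one fixed scale. -/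
theorem IsHarmonicField.ae_eq_mollify (hΩ : IsOpen Ω) (hb : Bornology.IsBounded Ω) {p q : L2 Ω}
    (h : IsHarmonicField p q) {x₀ : Plane} {r : ℝ} (hr : 0 < r)
    (hx : Metric.closedBall x₀ (2 * r) ⊆ Ω) {s : ℝ} (hs : r⁻¹ < s) :
    ∀ᵐ x ∂volume.restrict (Metric.ball x₀ r), p x = mollify Ω p s x := by
  rw [ae_restrict_iff' Metric.isOpen_ball.measurableSet]
  filter_upwards [ae_tendsto_mollify (integrable_indicator_L2 hΩ hb p)] with x hlim hxr
  have hball : Metric.closedBall x r ⊆ Ω := by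
    refine (Metric.closedBall_subset_closedBall' ?_).trans hx
    have := Metric.mem_ball.1 hxr
    linarith
  have hxΩ : x ∈ Ω := hball (Metric.mem_closedBall_self hr.le)
  rw [Set.indicator_of_mem hxΩ] at hlim
  refine tendsto_nhds_unique hlim (tendsto_const_nhds.congr' ?_)
  filter_upwards [Filter.eventually_gt_atTop r⁻¹] with t ht
  rw [← setIntegral_mul_eq_indicator hΩ p, mollify]
  simp only [mollifyKernel, mul_left_comm (p _) (∫ z, radialBump z)⁻¹]
  rw [integral_const_mul, integral_const_mul, h.mollify_eq hb hr hball hs ht]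

/-- Locally a divergence free and curl free field is the gradient of a `C¹` function. -/
theorem IsHarmonicField.exists_local_potential (hΩ : IsOpen Ω) (hb : Bornology.IsBounded Ω)
    {a : Fin 2 → L2 Ω} (h : IsHarmonicField (a 0) (a 1)) {x₀ : Plane} (hx₀ : x₀ ∈ Ω) :
    ∃ r : ℝ, 0 < r ∧ Metric.ball x₀ r ⊆ Ω ∧ ∃ (F : Plane → ℝ) (F' : Plane → Plane →L[ℝ] ℝ),
      Continuous F' ∧ (∀ x ∈ Metric.ball x₀ r, HasFDerivAt F (F' x) x) ∧
      ∀ i, ∀ᵐ x ∂volume.restrict (Metric.ball x₀ r),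
        a i x = F' x (EuclideanSpace.single i 1) := by
  obtain ⟨R, hR, hRΩ⟩ := Metric.nhds_basis_closedBall.mem_iff.1 (hΩ.mem_nhds hx₀)
  set r := R / 2 with hrdef
  have hr : 0 < r := by positivity
  have hx2 : Metric.closedBall x₀ (2 * r) ⊆ Ω := by
    rwa [show 2 * r = R by rw [hrdef]; ring]
  have hball : Metric.ball x₀ r ⊆ Ω :=
    (Metric.ball_subset_closedBall.trans
      (Metric.closedBall_subset_closedBall (by linarith))).trans hx2
  set s := 2 * r⁻¹ with hsdef
  have hri : 0 < r⁻¹ := inv_pos.2 hr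
  have hs0 : 0 < s := by positivity
  have hs : r⁻¹ < s := by linarith
  let P : Fin 2 → Plane → ℝ := fun i => mollify Ω (a i) s
  have hP : ∀ i, ContDiff ℝ ∞ (P i) := fun i => contDiff_mollify hΩ hb (a i) hs0
  have hPa : ∀ i, ∀ᵐ x ∂volume.restrict (Metric.ball x₀ r), a i x = P i x := by
    intro i
    fin_cases i
    · exact h.ae_eq_mollify hΩ hb hr hx2 hs
    · exact h.rotate.ae_eq_mollify hΩ hb hr hx2 hs
  let α : Plane → Plane →L[ℝ] ℝ := fun x =>
    P 0 x • (EuclideanSpace.proj 0 : Plane →L[ℝ] ℝ) +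
      P 1 x • (EuclideanSpace.proj 1 : Plane →L[ℝ] ℝ)
  have hα : ∀ x, HasFDerivAt α
      ((fderiv ℝ (P 0) x).smulRight (EuclideanSpace.proj 0 : Plane →L[ℝ] ℝ) +
        (fderiv ℝ (P 1) x).smulRight (EuclideanSpace.proj 1 : Plane →L[ℝ] ℝ)) x := fun x =>
    (((hP 0).differentiable (by simp) x).hasFDerivAt.smul_const
      (EuclideanSpace.proj 0 : Plane →L[ℝ] ℝ)).add
      (((hP 1).differentiable (by simp) x).hasFDerivAt.smul_const
        (EuclideanSpace.proj 1 : Plane →L[ℝ] ℝ))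
  have hproj : ∀ (i : Fin 2) (v : Plane), (EuclideanSpace.proj i : Plane →L[ℝ] ℝ) v = v i :=
    fun _ _ => rfl
  have hcurl : ∀ x ∈ Metric.ball x₀ r, pderiv 1 (P 0) x = pderiv 0 (P 1) x := by
    intro x hx
    have hcb : Metric.closedBall x s⁻¹ ⊆ Ω := by
      refine (Metric.closedBall_subset_closedBall' ?_).trans hx2
      have h1 := Metric.mem_ball.1 hx
      have h2 : s⁻¹ ≤ r := inv_le_of_inv_le₀ hr hs.le
      linarith
    have hT : IsTest Ω fun y => mollifyKernel s (x - y) := by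
      have hT1 := (isTest_comp_smul_sub contDiff_radialBump tsupport_radialBump hs0
        hcb).const_smul ((∫ z, radialBump z)⁻¹ * s ^ 2)
      convert hT1 using 1
      funext y
      simp [mollifyKernel, mul_assoc]
    have hpd : ∀ i y, pderiv i (fun y => mollifyKernel s (x - y)) y =
        -pderiv i (mollifyKernel s) (x - y) := by
      intro i y
      simpa using pderiv_comp_smul_sub (contDiff_mollifyKernel s) x y 1 i
    have hcf := h.curl_free _ hT
    rw [inner_toL2, inner_toL2] at hcf
    simp only [hpd, mul_neg, integral_neg, neg_inj] at hcf
    rw [pderiv_mollify hΩ hb _ hs0, pderiv_mollify hΩ hb _ hs0, hcf]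
  obtain ⟨F, hF⟩ := (convex_ball x₀ r).exists_forall_hasFDerivAt_of_fderiv_symmetric
    Metric.isOpen_ball
    (show DifferentiableOn ℝ α _ from fun x _ =>
      (hα x).differentiableAt.differentiableWithinAt) (by
      intro x hx v w
      rw [(hα x).fderiv]
      simp only [add_apply, ContinuousLinearMap.smulRight_apply,
        smul_apply, hproj, smul_eq_mul,
        fderiv_apply_eq_sum]
      rw [hcurl x hx]
      ring)
  refine ⟨r, hr, hball, F, α, ?_, hF, fun i => ?_⟩
  · exact ((hP 0).continuous.smul continuous_const).add ((hP 1).continuous.smul continuous_const)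
  · filter_upwards [hPa i] with x hx
    rw [hx]
    fin_cases i <;> simp [α]

/-! ### The global potential -/

/-- On a bounded, simply connected open set, a divergence free and curl free field in `L²` is the
gradient of a `C¹` function. -/
theorem IsHarmonicField.exists_potential (hΩ : IsOpen Ω) (hb : Bornology.IsBounded Ω)
    (hsc : IsSimplyConnected Ω) {a : Fin 2 → L2 Ω} (h : IsHarmonicField (a 0) (a 1)) :
    ∃ (F : Plane → ℝ) (F' : Plane → Plane →L[ℝ] ℝ), ContinuousOn F' Ω ∧
      (∀ x ∈ Ω, HasFDerivAt F (F' x) x) ∧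
      ∀ i, ∀ᵐ x ∂volume.restrict Ω, a i x = F' x (EuclideanSpace.single i 1) := by
  have := hsc.simplyConnectedSpace
  have := hΩ.locallyPathConnectedSpace
  choose r hr hrΩ F F' hF'c hF hFa using fun x : Ω => h.exists_local_potential hΩ hb x.2
  have hbopen : ∀ x : Ω, IsOpen (Metric.ball (x : Plane) (r x)) := fun x => Metric.isOpen_ball
  -- Two continuous representatives of the field on an overlap coincide.
  have hF'eq : ∀ x y : Ω, Set.EqOn (F' x) (F' y)
      (Metric.ball (x : Plane) (r x) ∩ Metric.ball (y : Plane) (r y)) := by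
    intro x y
    refine Measure.eqOn_open_of_ae_eq (μ := volume) ?_ ((hbopen x).inter (hbopen y))
      (hF'c x).continuousOn (hF'c y).continuousOn
    have h1 := fun i => ae_restrict_of_ae_restrict_of_subset
      (Set.inter_subset_left (t := Metric.ball (y : Plane) (r y))) (hFa x i)
    have h2 := fun i => ae_restrict_of_ae_restrict_of_subset
      (Set.inter_subset_right (s := Metric.ball (x : Plane) (r x))) (hFa y i)
    filter_upwards [h1 0, h1 1, h2 0, h2 1] with z h10 h11 h20 h21
    ext v
    rw [clm_apply_eq_sum (F' x z), clm_apply_eq_sum (F' y z), ← h10, ← h11, h20, h21]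
  have hloc : ∀ x y : Ω, ∀ z ∈ Metric.ball (x : Plane) (r x) ∩ Metric.ball (y : Plane) (r y),
      ∀ᶠ w in nhds z, F x w - F y w = F x z - F y z := by
    intro x y z hz
    obtain ⟨ε, hε, hεs⟩ := Metric.isOpen_iff.1 ((hbopen x).inter (hbopen y)) z hz
    filter_upwards [Metric.ball_mem_nhds z hε] with w hw
    refine (convex_ball z ε).is_const_of_fderivWithin_eq_zero (𝕜 := ℝ)
      (f := fun w => F x w - F y w) (fun v hv => ?_) (fun v hv => ?_) hw (Metric.mem_ball_self hε)
    · exact ((hF x v (hεs hv).1).sub (hF y v (hεs hv).2)).differentiableAt.differentiableWithinAt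
    · rw [fderivWithin_of_isOpen Metric.isOpen_ball hv]
      change fderiv ℝ (F x - F y) v = 0
      rw [((hF x v (hεs hv).1).sub (hF y v (hεs hv).2)).fderiv, hF'eq x y (hεs hv), sub_self]
  obtain ⟨g, hg⟩ := exists_sub_locally_const_of_simplyConnected (X := Ω)
    (fun x : Ω => (Subtype.val ⁻¹' Metric.ball (x : Plane) (r x) : Set Ω))
    (fun x => (hbopen x).preimage continuous_subtype_val)
    (fun x => ⟨x, Metric.mem_ball_self (hr x)⟩) (fun x y => F x y) (fun x y z hz =>
      (continuous_subtype_val.continuousAt (x := z)).eventually (hloc x y z hz))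
  classical
  let G : Plane → ℝ := fun z => if hz : z ∈ Ω then g ⟨z, hz⟩ else 0
  let G' : Plane → Plane →L[ℝ] ℝ := fun z => if hz : z ∈ Ω then F' ⟨z, hz⟩ z else 0
  have hG'eq : ∀ x : Ω, Set.EqOn G' (F' x) (Metric.ball (x : Plane) (r x)) := by
    intro x z hz
    have hzΩ := hrΩ x hz
    simp only [G', dif_pos hzΩ]
    exact hF'eq ⟨z, hzΩ⟩ x ⟨Metric.mem_ball_self (hr _), hz⟩
  refine ⟨G, G', fun z hz => ?_, fun z hz => ?_, fun i => ?_⟩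
  · have hev : F' ⟨z, hz⟩ =ᶠ[nhds z] G' :=
      Filter.eventuallyEq_of_mem ((hbopen ⟨z, hz⟩).mem_nhds (Metric.mem_ball_self (hr _)))
        (hG'eq ⟨z, hz⟩).symm
    exact ((hF'c ⟨z, hz⟩).continuousAt.congr hev).continuousWithinAt
  · have h1 := hF ⟨z, hz⟩ z (Metric.mem_ball_self (hr _))
    have h2 := hg ⟨z, hz⟩ ⟨z, hz⟩ (Metric.mem_ball_self (hr _))
    rw [nhds_subtype_eq_comap, Filter.eventually_comap] at h2
    have h3 : G =ᶠ[nhds z] fun w => F ⟨z, hz⟩ w + (g ⟨z, hz⟩ - F ⟨z, hz⟩ z) := by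
      filter_upwards [h2, hΩ.mem_nhds hz] with w hw hwΩ
      have := hw ⟨w, hwΩ⟩ rfl
      simp only [G, dif_pos hwΩ]
      simp only at this
      linarith
    have h4 : G' z = F' ⟨z, hz⟩ z := hG'eq ⟨z, hz⟩ (Metric.mem_ball_self (hr _))
    rw [h4]
    exact (h1.add_const _).congr_of_eventuallyEq h3
  · -- A countable subfamily of the discs covers `Ω`.
    obtain ⟨T, hTc, hT⟩ := TopologicalSpace.isOpen_iUnion_countable
      (fun x : Ω => Metric.ball (x : Plane) (r x)) hbopen
    have hcov : Ω ⊆ ⋃ x ∈ T, Metric.ball (x : Plane) (r x) := by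
      rw [hT]
      exact fun z hz => Set.mem_iUnion.2 ⟨⟨z, hz⟩, Metric.mem_ball_self (hr _)⟩
    refine ae_restrict_of_ae_restrict_of_subset hcov ?_
    rw [ae_restrict_biUnion_iff _ hTc]
    intro x _
    filter_upwards [hFa x i, ae_restrict_mem (hbopen x).measurableSet] with z h1 h2
    rw [h1, hG'eq x h2]

/-- A divergence free and curl free field in `L²` on a simply connected set vanishes when its
normal trace does. With the potential `F` of the field, `arctan ∘ F` is an admissible test
function in `H¹(Ω)` even if `F` itself is not square integrable. -/
theorem IsHarmonicField.eq_zero (hΩ : IsOpen Ω) (hb : Bornology.IsBounded Ω)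
    (hsc : IsSimplyConnected Ω) {a : Fin 2 → L2 Ω} (h : IsHarmonicField (a 0) (a 1))
    (horth : ∀ f ∈ H1 Ω, ∑ i, inner ℝ (a i) (weakDeriv Ω i f) = (0 : ℝ)) : ∀ i, a i = 0 := by
  have := isFiniteMeasure_restrict_of_isBounded hb
  obtain ⟨F, F', hF'c, hF, hFa⟩ := h.exists_potential hΩ hb hsc
  have hFc : ContinuousOn F Ω := fun x hx => (hF x hx).continuousAt.continuousWithinAt
  have hmemf : MemLp (fun x => Real.arctan (F x)) 2 (volume.restrict Ω) := by
    refine MemLp.of_bound ((Real.continuous_arctan.comp_continuousOn hFc).aestronglyMeasurable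
      hΩ.measurableSet) (Real.pi / 2) (Filter.Eventually.of_forall fun x => ?_)
    exact (abs_lt.2 ⟨Real.neg_pi_div_two_lt_arctan _, Real.arctan_lt_pi_div_two _⟩).le
  have hmemg : ∀ i, MemLp (fun x => (1 + F x ^ 2)⁻¹ * a i x) 2 (volume.restrict Ω) := by
    intro i
    refine (Lp.memLp (a i)).of_le (AEStronglyMeasurable.mul ?_ (Lp.aestronglyMeasurable _))
      (Filter.Eventually.of_forall fun x => ?_)
    · refine ContinuousOn.aestronglyMeasurable ?_ hΩ.measurableSet
      exact (continuousOn_const.add (hFc.pow 2)).inv₀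
        fun x _ => (by positivity : (0 : ℝ) < 1 + F x ^ 2).ne'
    · rw [norm_mul, norm_inv, Real.norm_of_nonneg (by positivity : (0 : ℝ) ≤ 1 + F x ^ 2)]
      refine mul_le_of_le_one_left (norm_nonneg _) (inv_le_one_of_one_le₀ ?_)
      nlinarith [sq_nonneg (F x)]
  -- The chain rule for `arctan ∘ F`, with `F'` replaced by the field it represents.
  have hw : ∀ i, HasWeakDeriv Ω i (hmemf.toLp _) ((hmemg i).toLp _) := by
    intro i χ hχ
    have hd : ∀ x ∈ Ω, HasFDerivAt (fun x => Real.arctan (F x))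
        ((1 / (1 + F x ^ 2)) • F' x) x := fun x hx => (hF x hx).arctan
    have hc : ContinuousOn (fun x => (1 / (1 + F x ^ 2)) • F' x) Ω := by
      have hc1 : ContinuousOn (fun x => 1 / (1 + F x ^ 2)) Ω :=
        continuousOn_const.div (continuousOn_const.add (hFc.pow 2))
          fun x _ => (by positivity : (0 : ℝ) < 1 + F x ^ 2).ne'
      exact hc1.smul hF'c
    have hibp := hχ.setIntegral_mul_pderiv hΩ hd hc i
    convert hibp using 1
    · refine integral_congr_ae ?_
      filter_upwards [hmemf.coeFn_toLp] with x hx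
      rw [hx]
    · congr 1
      refine integral_congr_ae ?_
      filter_upwards [(hmemg i).coeFn_toLp, hFa i] with x hx hx'
      rw [hx, hx']
      simp
  have hH1 : hmemf.toLp _ ∈ H1 Ω := fun i => ⟨_, hw i⟩
  have h0 := horth _ hH1
  have hterm : ∀ i, inner ℝ (a i) (weakDeriv Ω i (hmemf.toLp _)) =
      ∫ x in Ω, (1 + F x ^ 2)⁻¹ * a i x ^ 2 := by
    intro i
    rw [(hw i).weakDeriv_eq hΩ, inner_eq_integral]
    refine integral_congr_ae ?_
    filter_upwards [(hmemg i).coeFn_toLp] with x hx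
    rw [hx]; ring
  have hint : ∀ i, Integrable (fun x => (1 + F x ^ 2)⁻¹ * a i x ^ 2) (volume.restrict Ω) := by
    intro i
    refine (integrable_mul (a i) ((hmemg i).toLp _)).congr ?_
    filter_upwards [(hmemg i).coeFn_toLp] with x hx
    rw [hx]; ring
  have hnn : ∀ i x, 0 ≤ (1 + F x ^ 2)⁻¹ * a i x ^ 2 := fun i x => by positivity
  have hz : ∀ i, ∫ x in Ω, (1 + F x ^ 2)⁻¹ * a i x ^ 2 = 0 := by
    have hnn' : ∀ i, 0 ≤ ∫ x in Ω, (1 + F x ^ 2)⁻¹ * a i x ^ 2 := fun i =>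
      integral_nonneg (hnn i)
    simp only [hterm] at h0
    intro i
    exact (Finset.sum_eq_zero_iff_of_nonneg fun i _ => hnn' i).1 h0 i (Finset.mem_univ i)
  intro i
  have hae := (integral_eq_zero_iff_of_nonneg (hnn i) (hint i)).1 (hz i)
  refine (Lp.eq_zero_iff_ae_eq_zero).2 ?_
  filter_upwards [hae] with x hx
  have hpos : 0 < 1 + F x ^ 2 := by positivity
  simpa [hpos.ne'] using hx

/-! ### The stream function -/

theorem IsTest.toL2_mem_H10 (hφ : IsTest Ω φ) (hΩ : IsOpen Ω) : hφ.toL2 ∈ H10 Ω :=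
  (mem_H10_of_tendsto hΩ (g := fun i => (hφ.pderiv i).toL2) (fun _ : ℕ => hφ)
    tendsto_const_nhds fun _ => tendsto_const_nhds).1

theorem setIntegral_sum_mul (v w : Fin 2 → L2 Ω) :
    ∫ x in Ω, ∑ i, v i x * w i x = ∑ i, inner ℝ (v i) (w i) := by
  rw [integral_finsetSum _ fun i _ => integrable_mul (v i) (w i)]
  simp only [inner_eq_integral]

theorem neg_scalarCurl (v : Fin 2 → L2 Ω) (f : L2 Ω) :
    -scalarCurl Ω v f = inner ℝ (v 0) (weakDeriv Ω 1 f) - inner ℝ (v 1) (weakDeriv Ω 0 f) := by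
  rw [scalarCurl, neg_neg, integral_sub (integrable_mul _ _) (integrable_mul _ _),
    inner_eq_integral, inner_eq_integral]

theorem normalTraceZero_iff {v : Fin 2 → L2 Ω} {d : L2 Ω} : NormalTraceZero Ω v d ↔
    ∀ f ∈ H1 Ω, ∑ i, inner ℝ (v i) (weakDeriv Ω i f) + inner ℝ d f = (0 : ℝ) := by
  refine forall₂_congr fun f _ => ?_
  rw [setIntegral_sum_mul, ← inner_eq_integral]
  rfl

/-- The field `(-u₁, u₀)`; the gradient of the stream function is its orthogonal projection on
the gradients of `H¹₀(Ω)`. -/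
def rotField (u : Fin 2 → L2 Ω) : L2Field Ω := WithLp.toLp 2 ![-u 1, u 0]

theorem norm_rotField (u : Fin 2 → L2 Ω) : ‖rotField u‖ = normH u := by
  rw [rotField, norm_toLp_eq_normH, normH, normH]
  simp [Fin.sum_univ_two, add_comm]

theorem isInitialStreamFunction_iff {u : Fin 2 → L2 Ω} {ψ : L2 Ω} :
    IsInitialStreamFunction Ω u ψ ↔ ψ ∈ H10 Ω ∧ ∀ f ∈ H10 Ω,
      inner ℝ (WithLp.toLp 2 (grad Ω ψ) : L2Field Ω) (WithLp.toLp 2 (grad Ω f)) =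
        (inner ℝ (rotField u) (WithLp.toLp 2 (grad Ω f)) : ℝ) := by
  refine and_congr_right fun _ => forall₂_congr fun f _ => ?_
  rw [setIntegral_sum_mul, neg_scalarCurl]
  simp only [PiLp.inner_apply, rotField, Fin.sum_univ_two, grad, Matrix.cons_val_zero,
    Matrix.cons_val_one, inner_neg_left]
  rw [sub_eq_neg_add]

theorem exists_isInitialStreamFunction (hΩ : IsOpen Ω) (hb : Bornology.IsBounded Ω)
    (u : Fin 2 → L2 Ω) : ∃ ψ, IsInitialStreamFunction Ω u ψ := by
  have : CompleteSpace (gradSpace Ω) :=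
    (Submodule.isClosed_topologicalClosure _).completeSpace_coe
  obtain ⟨k, hk, g, hg, hkg⟩ := (gradSpace Ω).exists_add_mem_mem_orthogonal (rotField u)
  obtain ⟨ψ, hψ, hψk⟩ := exists_grad_eq_of_mem_gradSpace hΩ hb hk
  refine ⟨ψ, isInitialStreamFunction_iff.2 ⟨hψ, fun f hf => ?_⟩⟩
  rw [hkg, hψk, inner_add_left, Submodule.inner_left_of_mem_orthogonal (grad_mem_gradSpace hf) hg,
    add_zero]

theorem IsInitialStreamFunction.unique (hΩ : IsOpen Ω) (hb : Bornology.IsBounded Ω)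
    {u : Fin 2 → L2 Ω} {ψ ψ' : L2 Ω} (h : IsInitialStreamFunction Ω u ψ)
    (h' : IsInitialStreamFunction Ω u ψ') : ψ = ψ' := by
  obtain ⟨hψ, he⟩ := isInitialStreamFunction_iff.1 h
  obtain ⟨hψ', he'⟩ := isInitialStreamFunction_iff.1 h'
  refine eq_of_grad_eq hΩ hb hψ hψ' (WithLp.toLp_injective 2 (sub_eq_zero.1 ?_))
  rw [← inner_self_eq_zero (𝕜 := ℝ), inner_sub_right, inner_sub_left, inner_sub_left,
    he ψ hψ, he' ψ hψ, he ψ' hψ', he' ψ' hψ', sub_self, sub_self, sub_self]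

theorem IsInitialStreamFunction.normH10_le {u : Fin 2 → L2 Ω} {ψ : L2 Ω}
    (h : IsInitialStreamFunction Ω u ψ) : normH10 ψ ≤ normH u := by
  obtain ⟨hψ, he⟩ := isInitialStreamFunction_iff.1 h
  rw [normH10, ← norm_toLp_eq_normH, ← norm_rotField]
  have h1 := he ψ hψ
  rw [real_inner_self_eq_norm_sq] at h1
  have h2 := real_inner_le_norm (rotField u) (WithLp.toLp 2 (grad Ω ψ))
  rcases (norm_nonneg (WithLp.toLp 2 (grad Ω ψ) : L2Field Ω)).eq_or_lt with h0 | h0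
  · rw [← h0]; exact norm_nonneg _
  · exact le_of_mul_le_mul_right (by linarith [sq ‖(WithLp.toLp 2 (grad Ω ψ) : L2Field Ω)‖]) h0

/-- On a simply connected set the stream function of a field `u` in `H` satisfies
`u = (∂₁ψ, -∂₀ψ)`: the difference is divergence free, curl free by the equation for `ψ`, and has
vanishing normal trace. -/
theorem IsInitialStreamFunction.grad_eq (hΩ : IsOpen Ω) (hb : Bornology.IsBounded Ω)
    (hsc : IsSimplyConnected Ω) {u : Fin 2 → L2 Ω} (hu : u ∈ spaceH Ω) {ψ : L2 Ω}
    (h : IsInitialStreamFunction Ω u ψ) :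
    weakDeriv Ω 0 ψ = -u 1 ∧ weakDeriv Ω 1 ψ = u 0 := by
  have hψ := h.1
  let a : Fin 2 → L2 Ω := ![u 0 - weakDeriv Ω 1 ψ, u 1 + weakDeriv Ω 0 ψ]
  have horth : ∀ f ∈ H1 Ω, ∑ i, inner ℝ (a i) (weakDeriv Ω i f) = (0 : ℝ) := by
    intro f hf
    have h1 := normalTraceZero_iff.1 hu.2 f hf
    have h2 := inner_grad_comm_of_mem_H10 hf hψ 0 1
    rw [Fin.sum_univ_two, inner_zero_left, add_zero] at h1
    simp only [a, Fin.sum_univ_two, Matrix.cons_val_zero, Matrix.cons_val_one, inner_sub_left,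
      inner_add_left]
    linarith
  have hharm : IsHarmonicField (a 0) (a 1) := by
    refine ⟨fun χ hχ => ?_, fun χ hχ => ?_⟩
    · have h1 := horth _ (hχ.toL2_mem_H10 hΩ).1
      rw [Fin.sum_univ_two, (hχ.hasWeakDeriv hΩ 0).weakDeriv_eq hΩ,
        (hχ.hasWeakDeriv hΩ 1).weakDeriv_eq hΩ] at h1
      linarith
    · have h1 := h.2 _ (hχ.toL2_mem_H10 hΩ)
      rw [setIntegral_sum_mul, neg_scalarCurl, Fin.sum_univ_two] at h1
      simp only [grad, (hχ.hasWeakDeriv hΩ 0).weakDeriv_eq hΩ,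
        (hχ.hasWeakDeriv hΩ 1).weakDeriv_eq hΩ] at h1
      simp only [a, Matrix.cons_val_zero, Matrix.cons_val_one, inner_sub_left, inner_add_left]
      linarith
  have hz := hharm.eq_zero hΩ hb hsc horth
  exact ⟨eq_neg_of_add_eq_zero_right (hz 1), (sub_eq_zero.1 (hz 0)).symm⟩

theorem norm_weakDeriv_le_normV (v : Fin 2 → L2 Ω) (i j : Fin 2) :
    ‖weakDeriv Ω i (v j)‖ ≤ normV v := by
  have h1 : ‖weakDeriv Ω i (v j)‖ ≤ normH10 (v j) := by
    rw [normH10, ← norm_toLp_eq_normH]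
    exact PiLp.norm_apply_le (WithLp.toLp 2 (grad Ω (v j)) : L2Field Ω) i
  refine h1.trans (Real.le_sqrt_of_sq_le ?_)
  exact Finset.single_le_sum (f := fun j => normH10 (v j) ^ 2) (fun _ _ => sq_nonneg _)
    (Finset.mem_univ j)

/-- If the components of the gradient of `ψ` are, up to sign, in `H¹₀(Ω)`, then `ψ ∈ H²₀(Ω)`: the
Neumann condition is Green's formula for these components. -/
theorem mem_H20_of_grad_eq (hΩ : IsOpen Ω) {u : Fin 2 → L2 Ω} (hu : ∀ i, u i ∈ H10 Ω) {ψ : L2 Ω}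
    (hψ : ψ ∈ H10 Ω) (h0 : weakDeriv Ω 0 ψ = -u 1) (h1 : weakDeriv Ω 1 ψ = u 0) :
    ψ ∈ H20 Ω := by
  refine ⟨⟨hψ.1, fun i => ?_⟩, hψ, normalTraceZero_iff.2 fun f hf => ?_⟩
  · fin_cases i
    · exact h0 ▸ neg_mem_H1 (hu 1).1
    · exact h1 ▸ (hu 0).1
  · have e0 := inner_weakDeriv_of_mem_H10 hf (hu 1) 0
    have e1 := inner_weakDeriv_of_mem_H10 hf (hu 0) 1
    rw [laplacian, Fin.sum_univ_two, Fin.sum_univ_two]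
    simp only [grad, h0, h1, weakDeriv_neg hΩ (hu 1).1, inner_add_left, inner_neg_left, e0, e1]
    ring

theorem normH20_le_of_grad_eq (hΩ : IsOpen Ω) {u : Fin 2 → L2 Ω} (hu : ∀ i, u i ∈ H10 Ω)
    {ψ : L2 Ω} (h0 : weakDeriv Ω 0 ψ = -u 1) (h1 : weakDeriv Ω 1 ψ = u 0) :
    normH20 ψ ≤ 2 * normV u := by
  rw [normH20, laplacian, Fin.sum_univ_two, h0, h1, weakDeriv_neg hΩ (hu 1).1]
  refine (norm_add_le _ _).trans ?_
  rw [norm_neg, two_mul]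
  exact add_le_add (norm_weakDeriv_le_normV u 0 1) (norm_weakDeriv_le_normV u 1 0)

end StreamFunction

end

open StreamFunction in
theorem lemma2p4 (Ω : Set Plane) (hpoly : IsPolygonal Ω) (hsc : IsSimplyConnected Ω) :
    ∃ C : ℝ, 0 < C ∧ ∀ u₀ ∈ spaceH Ω,
      (∃! ψ₀ : L2 Ω, IsInitialStreamFunction Ω u₀ ψ₀) ∧
      ∀ ψ₀ : L2 Ω, IsInitialStreamFunction Ω u₀ ψ₀ →
        (ψ₀ ∈ H10 Ω ∧ normH10 ψ₀ ≤ C * normH u₀) ∧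
        (u₀ ∈ spaceV Ω → ψ₀ ∈ H20 Ω ∧ normH20 ψ₀ ≤ C * normV u₀) := by
  have hΩ := hpoly.isOpen
  have hb := hpoly.isBounded
  refine ⟨2, two_pos, fun u₀ hu => ⟨?_, fun ψ hψ => ⟨⟨hψ.1, ?_⟩, fun hV => ?_⟩⟩⟩
  · obtain ⟨ψ, hψ⟩ := exists_isInitialStreamFunction hΩ hb u₀
    exact ⟨ψ, hψ, fun ψ' hψ' => hψ'.unique hΩ hb hψ⟩
  · have h0 : 0 ≤ normH u₀ := Real.sqrt_nonneg _
    linarith [hψ.normH10_le]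
  · obtain ⟨h0, h1⟩ := hψ.grad_eq hΩ hb hsc hu
    exact ⟨mem_H20_of_grad_eq hΩ hV.1 hψ.1 h0 h1, normH20_le_of_grad_eq hΩ hV.1 h0 h1⟩
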